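/- Let $\mathbb{D}$ be the open unit disc and let $H^2(\mathbb{D})$ be the Hardy space of all analytic functions $f(z)=\sum_{k\ge 0}a_kz^k$ on $\mathbb{D}$ with $\|f\|^2=\sum_{k\ge 0}|a_k|^2<\infty$. Let $\mathbb{C}_+=\{s\in\mathbb{C}:\operatorname{Re}s>0\}$ and let $H^2(\mathbb{C}_+)$ be the Hardy space of all analytic functions $f$ on $\mathbb{C}_+$ with $\|f\|^2=\sup_{x>0}\int_{-\infty}^{\infty}|f(x+iy)|^2\,dy<\infty$. Let $\phi(z)=\exp\left(\frac{z-1}{z+1}\right)$ and, for real $\lambda\ge 0$, let $\phi^\lambda(z)=\exp\left(\lambda\,\frac{z-1}{z+1}\right)$ for $z\in\mathbb{D}$. Then: (1) For every $\lambda\ge 0$ the function $\phi^\lambda$ belongs to $H^2(\mathbb{D})$, and the closed linear span over $\mathbb{C}$, in the norm of $H^2(\mathbb{D})$, of $\{\phi^\lambda:\lambda\ge 0\}$ is the whole of $H^2(\mathbb{D})$. (2) For every $\lambda\ge 0$ the function $s\mapsto \frac{e^{-\lambda s}}{1+s}$ belongs to $H^2(\mathbb{C}_+)$, and the closed linear span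 over $\mathbb{C}$, in the norm of $H^2(\mathbb{C}_+)$, of $\left\{\frac{e^{-\lambda s}}{1+s}:\lambda\ge 0\right\}$ is the whole of $H^2(\mathbb{C}_+)$. -/

import Mathlib

open MeasureTheory
open scoped ENNReal

noncomputable section

/-- The extension by zero of a function on a set `U ⊆ ℂ` to the whole plane. -/
def zeroExt {U : Set ℂ} (f : U → ℂ) : ℂ → ℂ := Function.extend Subtype.val f 0

/-- For an open set `U`: the function `f : U → ℂ` is analytic. -/
def IsHolo {U : Set ℂ} (f : U → ℂ) : Prop := DifferentiableOn ℂ (zeroExt f) U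

theorem zeroExt_apply {U : Set ℂ} (f : U → ℂ) (z : U) : zeroExt f z = f z :=
  Subtype.val_injective.extend_apply f 0 z

theorem zeroExt_zero {U : Set ℂ} : zeroExt (0 : U → ℂ) = 0 :=
  Function.extend_zero _

theorem zeroExt_add {U : Set ℂ} (f g : U → ℂ) : zeroExt (f + g) = zeroExt f + zeroExt g := by
  have := Function.extend_add (Subtype.val : U → ℂ) f g 0 0
  simpa [zeroExt] using this

theorem zeroExt_smul {U : Set ℂ} (c : ℂ) (f : U → ℂ) : zeroExt (c • f) = c • zeroExt f := by
  have := Function.extend_smul c (Subtype.val : U → ℂ) f 0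
  simpa [zeroExt] using this

theorem IsHolo.zero {U : Set ℂ} : IsHolo (0 : U → ℂ) := by
  unfold IsHolo
  rw [zeroExt_zero]
  exact differentiableOn_const (0 : ℂ)

theorem IsHolo.add {U : Set ℂ} {f g : U → ℂ} (hf : IsHolo f) (hg : IsHolo g) :
    IsHolo (f + g) := by
  unfold IsHolo at *
  rw [zeroExt_add]
  exact DifferentiableOn.add hf hg

theorem IsHolo.smul {U : Set ℂ} (c : ℂ) {f : U → ℂ} (hf : IsHolo f) : IsHolo (c • f) := by
  unfold IsHolo at *
  rw [zeroExt_smul]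
  exact DifferentiableOn.const_smul hf c

/-! ### The Hardy space of the unit disc -/

/-- The open unit disc. -/
abbrev openDisc : Set ℂ := Metric.ball (0 : ℂ) 1

/-- The Taylor coefficient `a_k = f^(k)(0) / k!` of a function on the disc. -/
def taylorCoeff (f : openDisc → ℂ) (k : ℕ) : ℂ :=
  iteratedDeriv k (zeroExt f) 0 / (k.factorial : ℂ)

/-- `f` is analytic on the disc and its Taylor coefficients are square summable. -/
def MemHardyDisc (f : openDisc → ℂ) : Prop :=
  IsHolo f ∧ Summable fun k : ℕ => ‖taylorCoeff f k‖ ^ 2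

theorem IsHolo.contDiffAt {f : openDisc → ℂ} (hf : IsHolo f) (k : ℕ) :
    ContDiffAt ℂ k (zeroExt f) 0 :=
  (DifferentiableOn.analyticAt hf (Metric.ball_mem_nhds (0 : ℂ) one_pos)).contDiffAt

theorem taylorCoeff_zero (k : ℕ) : taylorCoeff 0 k = 0 := by
  have h : iteratedDeriv k (0 : ℂ → ℂ) 0 = 0 := by
    have := iteratedDeriv_const (n := k) (c := (0 : ℂ)) (x := (0 : ℂ))
    have h0 : (0 : ℂ → ℂ) = fun _ => 0 := rfl
    rw [h0, this]
    simp
  simp [taylorCoeff, zeroExt_zero, h]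

theorem taylorCoeff_add {f g : openDisc → ℂ} (hf : IsHolo f) (hg : IsHolo g) (k : ℕ) :
    taylorCoeff (f + g) k = taylorCoeff f k + taylorCoeff g k := by
  unfold taylorCoeff
  rw [zeroExt_add, iteratedDeriv_add (hf.contDiffAt k) (hg.contDiffAt k), add_div]

theorem taylorCoeff_smul (c : ℂ) {f : openDisc → ℂ} (hf : IsHolo f) (k : ℕ) :
    taylorCoeff (c • f) k = c * taylorCoeff f k := by
  unfold taylorCoeff
  rw [zeroExt_smul, iteratedDeriv_const_smul (hf.contDiffAt k), smul_eq_mul, mul_div_assoc]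

/-- An analytic function on the disc is the sum of its Taylor series at `0`. -/
theorem hasSum_taylorCoeff {f : openDisc → ℂ} (hf : IsHolo f) (z : openDisc) :
    HasSum (fun k : ℕ => taylorCoeff f k * (z : ℂ) ^ k) (f z) := by
  have h := Complex.hasSum_taylorSeries_on_ball hf z.2
  rw [zeroExt_apply] at h
  have e : (fun k : ℕ => taylorCoeff f k * (z : ℂ) ^ k) = fun k : ℕ =>
      (k.factorial : ℂ)⁻¹ • ((z : ℂ) - 0) ^ k • iteratedDeriv k (zeroExt f) 0 := by
    funext k
    simp only [taylorCoeff, smul_eq_mul, sub_zero]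
    ring
  rw [e]
  exact h

theorem memℓp_two_iff (a : ℕ → ℂ) : Memℓp a 2 ↔ Summable fun k : ℕ => ‖a k‖ ^ 2 := by
  rw [memℓp_gen_iff (by norm_num)]
  simp only [ENNReal.toReal_ofNat, Real.rpow_ofNat]

/-- The analytic functions on the disc with square-summable coefficients, as a vector space of functions. -/
def hardyDiscSubmodule : Submodule ℂ (openDisc → ℂ) where
  carrier := {f | MemHardyDisc f}
  zero_mem' := ⟨IsHolo.zero, by simp [taylorCoeff_zero, summable_zero]⟩
  add_mem' := by
    rintro f g ⟨hf, hf'⟩ ⟨hg, hg'⟩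
    refine ⟨hf.add hg, ?_⟩
    rw [← memℓp_two_iff] at *
    have h : taylorCoeff (f + g) = taylorCoeff f + taylorCoeff g :=
      funext (taylorCoeff_add hf hg)
    rw [h]
    exact hf'.add hg'
  smul_mem' := by
    rintro c f ⟨hf, hf'⟩
    refine ⟨hf.smul c, ?_⟩
    simp only [taylorCoeff_smul c hf, norm_mul, mul_pow]
    exact hf'.mul_left _

/-- The Hardy space `H²(𝔻)`. It is a separate type so that it carries only the topology of the
Hardy norm, and not that of pointwise convergence. -/
def HardyDisc : Type := hardyDiscSubmodule

namespace HardyDisc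

instance : AddCommGroup HardyDisc := inferInstanceAs (AddCommGroup hardyDiscSubmodule)

instance : Module ℂ HardyDisc := inferInstanceAs (Module ℂ hardyDiscSubmodule)

/-- The underlying function on the disc. -/
def toFun (f : HardyDisc) : openDisc → ℂ := Subtype.val f

theorem mem (f : HardyDisc) : MemHardyDisc f.toFun := Subtype.property f

theorem toFun_injective : Function.Injective toFun := Subtype.val_injective

/-- The sequence of Taylor coefficients, as an element of `ℓ²`. -/
def toLp (f : HardyDisc) : lp (fun _ : ℕ => ℂ) 2 :=
  ⟨taylorCoeff f.toFun, (memℓp_two_iff _).2 f.mem.2⟩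

theorem toLp_add (f g : HardyDisc) : (f + g).toLp = f.toLp + g.toLp :=
  Subtype.ext (funext (taylorCoeff_add f.mem.1 g.mem.1))

theorem toLp_smul (c : ℂ) (f : HardyDisc) : (c • f).toLp = c • f.toLp :=
  Subtype.ext (funext (taylorCoeff_smul c f.mem.1))

theorem toLp_injective : Function.Injective toLp := by
  intro f g h
  apply toFun_injective
  funext z
  have h' : taylorCoeff f.toFun = taylorCoeff g.toFun := congrArg Subtype.val h
  have hf := hasSum_taylorCoeff f.mem.1 z
  rw [h'] at hf
  exact hf.unique (hasSum_taylorCoeff g.mem.1 z)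

/-- `‖f‖² = ∑ |a_k|²`. -/
instance : Norm HardyDisc := ⟨fun f => Real.sqrt (∑' k : ℕ, ‖taylorCoeff f.toFun k‖ ^ 2)⟩

theorem norm_def (f : HardyDisc) :
    ‖f‖ = Real.sqrt (∑' k : ℕ, ‖taylorCoeff f.toFun k‖ ^ 2) := rfl

theorem norm_toLp (f : HardyDisc) : ‖f.toLp‖ = ‖f‖ := by
  rw [norm_def, lp.norm_eq_tsum_rpow (by norm_num), Real.sqrt_eq_rpow]
  simp [toLp]

theorem normCore : NormedSpace.Core ℂ HardyDisc where
  norm_nonneg f := Real.sqrt_nonneg _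
  norm_smul c f := by rw [← norm_toLp, ← norm_toLp, toLp_smul, norm_smul]
  norm_triangle f g := by
    rw [← norm_toLp, ← norm_toLp, ← norm_toLp, toLp_add]
    exact norm_add_le _ _
  norm_eq_zero_iff f := by
    have h0 : toLp 0 = 0 := by simpa using toLp_smul 0 0
    rw [← norm_toLp, norm_eq_zero, ← h0, toLp_injective.eq_iff]

instance : NormedAddCommGroup HardyDisc := NormedAddCommGroup.ofCore normCore

instance : NormedSpace ℂ HardyDisc := NormedSpace.ofCore normCore

end HardyDisc

/-! ### The Hardy space of the right half-plane -/

/-- The open right half-plane. -/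
abbrev rightHalfPlane : Set ℂ := {s : ℂ | 0 < s.re}

/-- `sup_{x > 0} ∫ |f(x + iy)|² dy`, with values in `[0, ∞]`. -/
def halfPlaneNormSq (f : rightHalfPlane → ℂ) : ℝ≥0∞ :=
  ⨆ x : {x : ℝ // 0 < x}, ∫⁻ y : ℝ, ‖zeroExt f (((x : ℝ) : ℂ) + (y : ℂ) * Complex.I)‖ₑ ^ 2

/-- `f` is analytic on the half-plane and its square integrals over vertical lines are bounded. -/
def MemHardyHalfPlane (f : rightHalfPlane → ℂ) : Prop :=
  IsHolo f ∧ halfPlaneNormSq f < ∞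

/-- The restriction of `f` to the vertical line with real part `x`. -/
def vertLine (f : rightHalfPlane → ℂ) (x : ℝ) (y : ℝ) : ℂ :=
  zeroExt f ((x : ℂ) + (y : ℂ) * Complex.I)

theorem IsHolo.continuous_vertLine {f : rightHalfPlane → ℂ} (hf : IsHolo f) {x : ℝ}
    (hx : 0 < x) : Continuous (vertLine f x) :=
  (DifferentiableOn.continuousOn hf).comp_continuous (by fun_prop) (fun y => by simpa using hx)

theorem eLpNorm_two_sq (g : ℝ → ℂ) : eLpNorm g 2 volume ^ 2 = ∫⁻ y, ‖g y‖ₑ ^ 2 := by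
  rw [eLpNorm_eq_lintegral_rpow_enorm_toReal (by norm_num) (by norm_num), ← ENNReal.rpow_natCast,
    ← ENNReal.rpow_mul]
  simp

theorem halfPlaneNormSq_le_iff (f : rightHalfPlane → ℂ) (c : ℝ≥0∞) :
    halfPlaneNormSq f ≤ c ^ 2 ↔ ∀ x : ℝ, 0 < x → eLpNorm (vertLine f x) 2 volume ≤ c := by
  unfold halfPlaneNormSq
  rw [iSup_le_iff, Subtype.forall]
  refine forall_congr' fun x => forall_congr' fun _ => ?_
  have h := eLpNorm_two_sq (vertLine f x)
  unfold vertLine at h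
  rw [← h]
  exact ENNReal.pow_le_pow_left_iff two_ne_zero

/-- `sup_{x > 0} ‖f(x + i·)‖_{L²}` with values in `[0, ∞]`. -/
def halfPlaneENorm (f : rightHalfPlane → ℂ) : ℝ≥0∞ := halfPlaneNormSq f ^ (1 / 2 : ℝ)

theorem halfPlaneENorm_sq (f : rightHalfPlane → ℂ) :
    halfPlaneENorm f ^ 2 = halfPlaneNormSq f := by
  rw [halfPlaneENorm, ← ENNReal.rpow_natCast, ← ENNReal.rpow_mul]
  simp

theorem halfPlaneENorm_le_iff (f : rightHalfPlane → ℂ) (c : ℝ≥0∞) :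
    halfPlaneENorm f ≤ c ↔ ∀ x : ℝ, 0 < x → eLpNorm (vertLine f x) 2 volume ≤ c := by
  rw [← halfPlaneNormSq_le_iff, ← halfPlaneENorm_sq]
  exact (ENNReal.pow_le_pow_left_iff two_ne_zero).symm

theorem halfPlaneENorm_lt_top_iff (f : rightHalfPlane → ℂ) :
    halfPlaneENorm f < ∞ ↔ halfPlaneNormSq f < ∞ := by
  rw [← halfPlaneENorm_sq, ENNReal.pow_lt_top_iff]
  simp

theorem halfPlaneENorm_add {f g : rightHalfPlane → ℂ} (hf : IsHolo f) (hg : IsHolo g) :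
    halfPlaneENorm (f + g) ≤ halfPlaneENorm f + halfPlaneENorm g := by
  rw [halfPlaneENorm_le_iff]
  intro x hx
  have h : vertLine (f + g) x = vertLine f x + vertLine g x := by
    funext y
    simp [vertLine, zeroExt_add]
  rw [h]
  refine (eLpNorm_add_le (hf.continuous_vertLine hx).aestronglyMeasurable
    (hg.continuous_vertLine hx).aestronglyMeasurable (by norm_num)).trans ?_
  exact add_le_add ((halfPlaneENorm_le_iff f _).1 le_rfl x hx)
    ((halfPlaneENorm_le_iff g _).1 le_rfl x hx)

theorem halfPlaneNormSq_smul (c : ℂ) (f : rightHalfPlane → ℂ) :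
    halfPlaneNormSq (c • f) = ‖c‖ₑ ^ 2 * halfPlaneNormSq f := by
  unfold halfPlaneNormSq
  rw [ENNReal.mul_iSup]
  refine iSup_congr fun x => ?_
  rw [← lintegral_const_mul' _ _ (by simp)]
  refine lintegral_congr fun y => ?_
  simp [zeroExt_smul, enorm_mul, mul_pow]

theorem halfPlaneENorm_smul (c : ℂ) (f : rightHalfPlane → ℂ) :
    halfPlaneENorm (c • f) = ‖c‖ₑ * halfPlaneENorm f := by
  unfold halfPlaneENorm
  rw [halfPlaneNormSq_smul, ENNReal.mul_rpow_of_nonneg _ _ (by norm_num),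
    ← ENNReal.rpow_natCast, ← ENNReal.rpow_mul]
  simp

theorem halfPlaneENorm_zero : halfPlaneENorm 0 = 0 := by
  simpa using halfPlaneENorm_smul 0 0

theorem eq_zero_of_halfPlaneENorm {f : rightHalfPlane → ℂ} (hf : IsHolo f)
    (h : halfPlaneENorm f = 0) : f = 0 := by
  funext s
  have hs : 0 < (s : ℂ).re := s.2
  have h1 := (halfPlaneENorm_le_iff f 0).1 h.le _ hs
  rw [nonpos_iff_eq_zero, eLpNorm_eq_zero_iff
    (hf.continuous_vertLine hs).aestronglyMeasurable (by norm_num)] at h1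
  have h2 : vertLine f (s : ℂ).re = 0 :=
    ((hf.continuous_vertLine hs).ae_eq_iff_eq volume continuous_zero).1 h1
  have h3 := congrFun h2 (s : ℂ).im
  unfold vertLine at h3
  rw [Complex.re_add_im, zeroExt_apply] at h3
  exact h3

/-- The functions in the Hardy class of the half-plane as a vector space of functions. -/
def hardyHalfPlaneSubmodule : Submodule ℂ (rightHalfPlane → ℂ) where
  carrier := {f | MemHardyHalfPlane f}
  zero_mem' := ⟨IsHolo.zero, by rw [← halfPlaneENorm_lt_top_iff, halfPlaneENorm_zero]; simp⟩
  add_mem' := by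
    rintro f g ⟨hf, hf'⟩ ⟨hg, hg'⟩
    rw [← halfPlaneENorm_lt_top_iff] at hf' hg'
    refine ⟨hf.add hg, ?_⟩
    rw [← halfPlaneENorm_lt_top_iff]
    exact (halfPlaneENorm_add hf hg).trans_lt (ENNReal.add_lt_top.2 ⟨hf', hg'⟩)
  smul_mem' := by
    rintro c f ⟨hf, hf'⟩
    rw [← halfPlaneENorm_lt_top_iff] at hf'
    refine ⟨hf.smul c, ?_⟩
    rw [← halfPlaneENorm_lt_top_iff, halfPlaneENorm_smul]
    exact ENNReal.mul_lt_top (by simp) hf'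

/-- The Hardy space `H²(ℂ₊)` of the right half-plane, again as a separate type. -/
def HardyHalfPlane : Type := hardyHalfPlaneSubmodule

namespace HardyHalfPlane

instance : AddCommGroup HardyHalfPlane := inferInstanceAs (AddCommGroup hardyHalfPlaneSubmodule)

instance : Module ℂ HardyHalfPlane := inferInstanceAs (Module ℂ hardyHalfPlaneSubmodule)

/-- The underlying function on the half-plane. -/
def toFun (f : HardyHalfPlane) : rightHalfPlane → ℂ := Subtype.val f

theorem mem (f : HardyHalfPlane) : MemHardyHalfPlane f.toFun := Subtype.property f

theorem toFun_injective : Function.Injective toFun := Subtype.val_injective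

/-- `‖f‖² = sup_{x > 0} ∫ |f(x + iy)|² dy`. -/
instance : Norm HardyHalfPlane := ⟨fun f => Real.sqrt (halfPlaneNormSq f.toFun).toReal⟩

theorem norm_def (f : HardyHalfPlane) : ‖f‖ = Real.sqrt (halfPlaneNormSq f.toFun).toReal := rfl

theorem norm_eq (f : HardyHalfPlane) : ‖f‖ = (halfPlaneENorm f.toFun).toReal := by
  rw [norm_def, ← halfPlaneENorm_sq, ENNReal.toReal_pow, Real.sqrt_sq ENNReal.toReal_nonneg]

theorem enorm_ne_top (f : HardyHalfPlane) : halfPlaneENorm f.toFun ≠ ∞ :=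
  ((halfPlaneENorm_lt_top_iff _).2 f.mem.2).ne

theorem normCore : NormedSpace.Core ℂ HardyHalfPlane where
  norm_nonneg f := Real.sqrt_nonneg _
  norm_smul c f := by
    rw [norm_eq, norm_eq, ← toReal_enorm c, ← ENNReal.toReal_mul, ← halfPlaneENorm_smul]
    rfl
  norm_triangle f g := by
    rw [norm_eq, norm_eq, norm_eq, ← ENNReal.toReal_add f.enorm_ne_top g.enorm_ne_top]
    exact ENNReal.toReal_mono (ENNReal.add_ne_top.2 ⟨f.enorm_ne_top, g.enorm_ne_top⟩)
      (halfPlaneENorm_add f.mem.1 g.mem.1)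
  norm_eq_zero_iff f := by
    rw [norm_eq, ENNReal.toReal_eq_zero_iff, or_iff_left f.enorm_ne_top]
    constructor
    · intro h
      exact toFun_injective (eq_zero_of_halfPlaneENorm f.mem.1 h)
    · rintro rfl
      exact halfPlaneENorm_zero

instance : NormedAddCommGroup HardyHalfPlane := NormedAddCommGroup.ofCore normCore

instance : NormedSpace ℂ HardyHalfPlane := NormedSpace.ofCore normCore

end HardyHalfPlane

/-! ### The two families of functions -/

/-- The power `φ^t` of the singular inner function `φ(z) = exp((z - 1) / (z + 1))`; it is
`exp(t (z - 1) / (z + 1))`, with the analytic choice `(z - 1) / (z + 1)` of `log φ`. -/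
def singularPow (t : ℝ) (z : openDisc) : ℂ :=
  Complex.exp ((t : ℂ) * (((z : ℂ) - 1) / ((z : ℂ) + 1)))

/-- The function `e^{-t s} / (1 + s)` on the right half-plane. -/
def expKernel (t : ℝ) (s : rightHalfPlane) : ℂ :=
  Complex.exp (-(t : ℂ) * (s : ℂ)) / (1 + (s : ℂ))

end

/-! On the disc, pass to Taylor coefficients and work in the Hilbert space `ℓ²`. The Laplace
transform of `t ↦ φ^t` at `w > 0` is `1 / (w - (z - 1) / (z + 1))`, a Möbius function of `z`. For `w
= (1 - r) / (1 + r)` with `0 < r < 1` it equals `α + β / (1 - r z)` with `β ≠ 0`: a combination of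
the constant `φ^0` and the reproducing kernel at `r` (`integral_exp_smul_singularElt_eq`). A vector
orthogonal to every `φ^t` is therefore orthogonal to the kernels at all points of `(0, 1)`. The
analytic function whose coefficients it supplies vanishes there, so the vector is zero by the
identity theorem (`eq_zero_of_inner_discKernel`).

The half-plane case is transported from the disc by `f ↦ f((1 - s) / (1 + s)) / (1 + s)`, which
sends `φ^t` to `e^{-ts} / (1 + s)`. A continuous surjection maps dense sets to dense sets, so it
suffices that this operator is bounded and onto; that it is an isometry up to a constant is never
needed.

Boundedness: the line `Re s = x` corresponds to the circle of centre `r - 1` and radius `r = 1 / (1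
+ x)`, internally tangent to the unit circle at `-1` (`lintegral_line_cayley`). Integrals over that
circle are those of `ζ ↦ f(r - 1 + r ζ)` over the unit circle, and this substitution is bounded on
`ℓ²` by Schur's test applied to the binomial matrix (`exists_affine_coeff`).

Surjectivity: the inverse transform `g` of `f` has uniformly bounded integrals over the tangent
circles, and these must yield bounds over concentric circles. Since `f` is bounded on `Re s ≥ x`,
the only unboundedness of `g(r - 1 + r ζ)` comes from the pole of `1 / (1 + ζ)`. The factor `(1 + ζ)
/ (1 + x + ζ)`, of modulus at most one, removes it. The product is bounded, so its concentric means
are at most its boundary integral (`lintegral_circleMap_regularized_le`), and Fatou's lemma as `x →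
0` concludes. -/

noncomputable section

/-! ### Quadratic means over circles -/

open Filter Topology in
/-- Parseval's identity for polynomials on the unit circle. -/
theorem lintegral_circle_sum_sq (a : ℕ → ℂ) (N : ℕ) :
    ∫⁻ θ in Set.Ioo (-Real.pi) Real.pi,
      ‖∑ k ∈ Finset.range N, a k * circleMap 0 1 θ ^ k‖ₑ ^ 2 =
      ENNReal.ofReal (2 * Real.pi * ∑ k ∈ Finset.range N, ‖a k‖ ^ 2) := by
  set p : Polynomial ℂ := ∑ k ∈ Finset.range N, Polynomial.C (a k) * Polynomial.X ^ k with hp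
  have hev : ∀ z, p.eval z = ∑ k ∈ Finset.range N, a k * z ^ k := by
    intro z
    simp [hp, Polynomial.eval_finsetSum]
  have hco : ∀ k, p.coeff k = if k ∈ Finset.range N then a k else 0 := by
    intro k
    simp [hp, Polynomial.coeff_X_pow, Finset.sum_ite_eq]
  have h1 : ∑ k ∈ p.support, ‖p.coeff k‖ ^ 2 = ∑ k ∈ Finset.range N, ‖a k‖ ^ 2 := by
    have hs : p.support ⊆ Finset.range N := by
      intro k hk
      by_contra h
      rw [Polynomial.mem_support_iff, hco, if_neg h] at hk
      exact hk rfl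
    rw [Finset.sum_subset hs]
    · refine Finset.sum_congr rfl fun k hk => ?_
      rw [hco, if_pos hk]
    · intro k _ hk
      rw [Polynomial.notMem_support_iff.1 hk]
      simp
  have hc : Continuous fun θ : ℝ => ‖p.eval (circleMap 0 1 θ)‖ ^ 2 :=
    ((p.continuous.comp (continuous_circleMap 0 1)).norm).pow 2
  have h2 := p.sum_sq_norm_coeff_eq_circleAverage
  rw [h1, Real.circleAverage, smul_eq_mul, eq_inv_mul_iff_mul_eq₀ (by positivity)] at h2
  rw [h2]
  -- The circle is cut at `-1`, so that the open interval `(-π, π)` omits the tangency point of the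
  -- circles used later.
  have hper : Function.Periodic (fun θ : ℝ => ‖p.eval (circleMap 0 1 θ)‖ ^ 2) (2 * Real.pi) := by
    intro θ
    simp only [(periodic_circleMap 0 1) θ]
  have h3 := hper.intervalIntegral_add_eq 0 (-Real.pi)
  rw [zero_add, show -Real.pi + 2 * Real.pi = Real.pi by ring] at h3
  rw [h3, intervalIntegral.integral_of_le (by linarith [Real.pi_pos]),
    ofReal_integral_eq_lintegral_ofReal (hc.integrableOn_Icc.mono_set Set.Ioc_subset_Icc_self)
      (Eventually.of_forall fun θ => by positivity), restrict_Ioo_eq_restrict_Ioc]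
  refine lintegral_congr fun θ => ?_
  rw [hev, ENNReal.ofReal_pow (norm_nonneg _), ofReal_norm]

open Filter Topology in
/-- Parseval's identity for absolutely convergent power series on the unit circle. -/
theorem lintegral_circle_tsum_sq {a : ℕ → ℂ} (ha : Summable fun k => ‖a k‖) {f : ℝ → ℂ}
    (hf : ∀ θ, HasSum (fun k => a k * circleMap 0 1 θ ^ k) (f θ)) :
    ∫⁻ θ in Set.Ioo (-Real.pi) Real.pi, ‖f θ‖ₑ ^ 2 =
      ENNReal.ofReal (2 * Real.pi * ∑' k, ‖a k‖ ^ 2) := by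
  have hsq : Summable fun k => ‖a k‖ ^ 2 := by
    refine Summable.of_norm_bounded_eventually_nat ha ?_
    filter_upwards [ha.tendsto_atTop_zero.eventually (gt_mem_nhds one_pos)] with k hk
    rw [Real.norm_of_nonneg (by positivity)]
    nlinarith [norm_nonneg (a k)]
  have h1 : Tendsto (fun N => ∫⁻ θ in Set.Ioo (-Real.pi) Real.pi,
      ‖∑ k ∈ Finset.range N, a k * circleMap 0 1 θ ^ k‖ₑ ^ 2) atTop
      (𝓝 (∫⁻ θ in Set.Ioo (-Real.pi) Real.pi, ‖f θ‖ₑ ^ 2)) := by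
    refine tendsto_lintegral_of_dominated_convergence
      (fun _ => ENNReal.ofReal (∑' k, ‖a k‖) ^ 2) (fun N => ?_)
      (fun N => Eventually.of_forall fun θ => ?_) ?_ (Eventually.of_forall fun θ => ?_)
    · have : Continuous fun θ : ℝ => ∑ k ∈ Finset.range N, a k * circleMap 0 1 θ ^ k :=
        continuous_finsetSum _ fun k _ => continuous_const.mul ((continuous_circleMap 0 1).pow k)
      exact (this.measurable.enorm).pow_const 2
    · dsimp only
      gcongr
      rw [← ofReal_norm]
      refine ENNReal.ofReal_le_ofReal ((norm_sum_le _ _).trans ?_)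
      have : ∀ k ∈ Finset.range N, ‖a k * circleMap 0 1 θ ^ k‖ = ‖a k‖ := by
        intro k _
        simp
      rw [Finset.sum_congr rfl this]
      exact ha.sum_le_tsum _ fun k _ => norm_nonneg _
    · rw [lintegral_const]
      exact ENNReal.mul_ne_top (by simp) (by simp)
    · exact ((ENNReal.continuous_pow 2).tendsto _).comp
        ((continuous_enorm.tendsto _).comp (hf θ).tendsto_sum_nat)
  simp_rw [lintegral_circle_sum_sq] at h1
  exact tendsto_nhds_unique h1 (ENNReal.tendsto_ofReal
    (hsq.hasSum.tendsto_sum_nat.const_mul _))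

/-- Parseval's identity on the circle of radius `ρ < 1`. -/
theorem lintegral_circleMap_sq {a : ℕ → ℂ} {f : ℂ → ℂ}
    (hf : ∀ z ∈ Metric.ball (0 : ℂ) 1, HasSum (fun k => a k * z ^ k) (f z)) {ρ : ℝ}
    (h0 : 0 ≤ ρ) (h1 : ρ < 1) :
    (Summable fun k => ‖a k‖ ^ 2 * ρ ^ (2 * k)) ∧
    ∫⁻ θ in Set.Ioo (-Real.pi) Real.pi, ‖f (circleMap 0 ρ θ)‖ₑ ^ 2 =
      ENNReal.ofReal (2 * Real.pi * ∑' k, ‖a k‖ ^ 2 * ρ ^ (2 * k)) := by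
  have hs : Summable fun k => ‖a k * (ρ : ℂ) ^ k‖ :=
    (hf ρ (by simpa [abs_of_nonneg h0] using h1)).summable.norm
  have e : ∀ k, ‖a k * (ρ : ℂ) ^ k‖ ^ 2 = ‖a k‖ ^ 2 * ρ ^ (2 * k) := by
    intro k
    rw [norm_mul, norm_pow, Complex.norm_real, Real.norm_of_nonneg h0, mul_pow, ← pow_mul,
      mul_comm k]
  have hsq : Summable fun k => ‖a k * (ρ : ℂ) ^ k‖ ^ 2 := by
    refine Summable.of_norm_bounded_eventually_nat hs ?_
    filter_upwards [hs.tendsto_atTop_zero.eventually (gt_mem_nhds one_pos)] with k hk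
    rw [Real.norm_of_nonneg (by positivity)]
    nlinarith [norm_nonneg (a k * (ρ : ℂ) ^ k)]
  have := lintegral_circle_tsum_sq hs (f := fun θ => f (circleMap 0 ρ θ)) (fun θ => by
    have h := hf (circleMap 0 ρ θ) (by simpa [abs_of_nonneg h0] using h1)
    convert h using 2 with k
    simp only [circleMap_zero, Complex.ofReal_one, one_mul, mul_pow]
    ring)
  simp_rw [e] at this hsq
  exact ⟨hsq, this⟩

/-- The quadratic means over circles increase with the radius. -/
theorem lintegral_circleMap_sq_mono {a : ℕ → ℂ} {f : ℂ → ℂ}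
    (hf : ∀ z ∈ Metric.ball (0 : ℂ) 1, HasSum (fun k => a k * z ^ k) (f z)) {ρ σ : ℝ}
    (h0 : 0 ≤ ρ) (h : ρ ≤ σ) (h1 : σ < 1) :
    ∫⁻ θ in Set.Ioo (-Real.pi) Real.pi, ‖f (circleMap 0 ρ θ)‖ₑ ^ 2 ≤
      ∫⁻ θ in Set.Ioo (-Real.pi) Real.pi, ‖f (circleMap 0 σ θ)‖ₑ ^ 2 := by
  have hρ := lintegral_circleMap_sq hf h0 (h.trans_lt h1)
  have hσ := lintegral_circleMap_sq hf (h0.trans h) h1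
  rw [hρ.2, hσ.2]
  refine ENNReal.ofReal_le_ofReal (mul_le_mul_of_nonneg_left ?_ (by positivity))
  refine hρ.1.tsum_le_tsum (fun k => ?_) hσ.1
  gcongr

open Filter Topology in
/-- Bounded quadratic means over circles give square summable coefficients. -/
theorem summable_sq_of_lintegral_circleMap_le {a : ℕ → ℂ} {f : ℂ → ℂ}
    (hf : ∀ z ∈ Metric.ball (0 : ℂ) 1, HasSum (fun k => a k * z ^ k) (f z)) {C : ℝ} (hC : 0 ≤ C)
    (h : ∀ ρ : ℝ, 0 < ρ → ρ < 1 → ∫⁻ θ in Set.Ioo (-Real.pi) Real.pi,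
      ‖f (circleMap 0 ρ θ)‖ₑ ^ 2 ≤ ENNReal.ofReal (2 * Real.pi * C)) :
    (Summable fun k => ‖a k‖ ^ 2) ∧ ∑' k, ‖a k‖ ^ 2 ≤ C := by
  have hN : ∀ N, ∑ k ∈ Finset.range N, ‖a k‖ ^ 2 ≤ C := by
    intro N
    have hlim : Tendsto (fun ρ : ℝ => ∑ k ∈ Finset.range N, ‖a k‖ ^ 2 * ρ ^ (2 * k)) (𝓝[<] 1)
        (𝓝 (∑ k ∈ Finset.range N, ‖a k‖ ^ 2)) := by
      have : Continuous fun ρ : ℝ => ∑ k ∈ Finset.range N, ‖a k‖ ^ 2 * ρ ^ (2 * k) := by fun_prop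
      simpa using (this.tendsto 1).mono_left nhdsWithin_le_nhds
    refine le_of_tendsto hlim ?_
    filter_upwards [Ioo_mem_nhdsLT (show (0 : ℝ) < 1 by norm_num)] with ρ hρ
    have hp := lintegral_circleMap_sq hf hρ.1.le hρ.2
    have h2 := h ρ hρ.1 hρ.2
    rw [hp.2, ENNReal.ofReal_le_ofReal_iff (by positivity),
      mul_le_mul_iff_right₀ (by positivity)] at h2
    exact (hp.1.sum_le_tsum _ fun k _ => by have := hρ.1; positivity).trans h2
  have hs := summable_of_sum_range_le (fun k => by positivity) hN
  exact ⟨hs, hs.tsum_le_of_sum_range_le hN⟩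

open Filter Topology in
/-- The quadratic means of a bounded function are at most that of its radial limit. -/
theorem lintegral_circleMap_sq_le_of_bounded {a : ℕ → ℂ} {f : ℂ → ℂ}
    (hf : ∀ z ∈ Metric.ball (0 : ℂ) 1, HasSum (fun k => a k * z ^ k) (f z))
    (hc : ContinuousOn f (Metric.ball (0 : ℂ) 1)) {C : ℝ}
    (hb : ∀ z ∈ Metric.ball (0 : ℂ) 1, ‖f z‖ ≤ C)
    (hr : ∀ θ ∈ Set.Ioo (-Real.pi) Real.pi, ContinuousAt f (circleMap 0 1 θ)) {ρ : ℝ}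
    (h0 : 0 ≤ ρ) (h1 : ρ < 1) :
    ∫⁻ θ in Set.Ioo (-Real.pi) Real.pi, ‖f (circleMap 0 ρ θ)‖ₑ ^ 2 ≤
      ∫⁻ θ in Set.Ioo (-Real.pi) Real.pi, ‖f (circleMap 0 1 θ)‖ₑ ^ 2 := by
  -- These radii start at `ρ` for `n = 0` and tend to `1`.
  set r : ℕ → ℝ := fun n => 1 - (1 - ρ) * (1 / ((n : ℝ) + 1)) with hrdef
  have hn : ∀ n : ℕ, 0 < 1 / ((n : ℝ) + 1) ∧ 1 / ((n : ℝ) + 1) ≤ 1 := fun n =>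
    ⟨by positivity, by rw [div_le_one (by positivity)]; linarith [n.cast_nonneg (α := ℝ)]⟩
  have hr1 : ∀ n, r n < 1 := fun n => by
    have := mul_pos (sub_pos.2 h1) (hn n).1
    simp only [hrdef]; linarith
  have hrρ : ∀ n, ρ ≤ r n := fun n => by
    have := mul_le_mul_of_nonneg_left (hn n).2 (sub_pos.2 h1).le
    simp only [hrdef]; linarith
  have hlim : Tendsto r atTop (𝓝 1) := by
    have := (tendsto_one_div_add_atTop_nhds_zero_nat (𝕜 := ℝ)).const_mul (1 - ρ)
    simpa [hrdef] using this.const_sub 1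
  have hmem : ∀ n θ, circleMap 0 (r n) θ ∈ Metric.ball (0 : ℂ) 1 := fun n θ => by
    simpa [abs_of_nonneg (h0.trans (hrρ n))] using hr1 n
  have h : Tendsto (fun n => ∫⁻ θ in Set.Ioo (-Real.pi) Real.pi, ‖f (circleMap 0 (r n) θ)‖ₑ ^ 2)
      atTop (𝓝 (∫⁻ θ in Set.Ioo (-Real.pi) Real.pi, ‖f (circleMap 0 1 θ)‖ₑ ^ 2)) := by
    refine tendsto_lintegral_of_dominated_convergence (fun _ => ENNReal.ofReal C ^ 2)
      (fun n => ?_) (fun n => Eventually.of_forall fun θ => ?_) ?_ ?_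
    · exact ((hc.comp_continuous (continuous_circleMap 0 (r n)) (hmem n)).measurable.enorm).pow_const 2
    · dsimp only
      gcongr
      rw [← ofReal_norm]
      exact ENNReal.ofReal_le_ofReal (hb _ (hmem n θ))
    · rw [lintegral_const]
      exact ENNReal.mul_ne_top (by simp) (by simp)
    · refine (ae_restrict_iff' measurableSet_Ioo).2 (Eventually.of_forall fun θ hθ => ?_)
      refine ((ENNReal.continuous_pow 2).tendsto _).comp ((continuous_enorm.tendsto _).comp ?_)
      refine (hr θ hθ).tendsto.comp ?_
      have : Continuous fun s : ℝ => circleMap 0 s θ := by unfold circleMap; fun_prop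
      exact (this.tendsto 1).comp hlim
  exact ge_of_tendsto' h fun n => lintegral_circleMap_sq_mono hf h0 (hrρ n) (hr1 n)

/-- The Taylor expansion of a holomorphic function on the unit disc. -/
theorem hasSum_iteratedDeriv_div {f : ℂ → ℂ} (hf : DifferentiableOn ℂ f (Metric.ball 0 1)) :
    ∀ z ∈ Metric.ball (0 : ℂ) 1,
      HasSum (fun k : ℕ => iteratedDeriv k f 0 / (k.factorial : ℂ) * z ^ k) (f z) := by
  intro z hz
  have e : (fun k : ℕ => iteratedDeriv k f 0 / (k.factorial : ℂ) * z ^ k) = fun k : ℕ =>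
      (k.factorial : ℂ)⁻¹ • (z - 0) ^ k • iteratedDeriv k f 0 := by
    funext k
    simp only [smul_eq_mul, sub_zero]
    ring
  rw [e]
  exact Complex.hasSum_taylorSeries_on_ball hf hz

/-! ### Holomorphic functions on the disc given by their Taylor coefficients -/

theorem eqOn_zeroExt {U : Set ℂ} (g : ℂ → ℂ) : Set.EqOn (zeroExt fun z : U => g z) g U :=
  fun z hz => zeroExt_apply (fun z : U => g z) ⟨z, hz⟩

theorem isHolo_of_differentiableOn {U : Set ℂ} {g : ℂ → ℂ} (hg : DifferentiableOn ℂ g U) :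
    IsHolo fun z : U => g z :=
  hg.congr (eqOn_zeroExt g)

/-- Bounded quadratic means over circles give membership in the Hardy space, with a norm bound. -/
theorem memHardyDisc_of_lintegral_le {f : openDisc → ℂ} (hf : IsHolo f) {C : ℝ} (hC : 0 ≤ C)
    (h : ∀ ρ : ℝ, 0 < ρ → ρ < 1 → ∫⁻ θ in Set.Ioo (-Real.pi) Real.pi,
      ‖zeroExt f (circleMap 0 ρ θ)‖ₑ ^ 2 ≤ ENNReal.ofReal (2 * Real.pi * C)) :
    MemHardyDisc f ∧ ∑' k, ‖taylorCoeff f k‖ ^ 2 ≤ C := by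
  have := summable_sq_of_lintegral_circleMap_le (hasSum_iteratedDeriv_div hf) hC h
  exact ⟨⟨hf, this.1⟩, this.2⟩

theorem memHardyDisc_of_norm_le {f : openDisc → ℂ} (hf : IsHolo f) {C : ℝ}
    (h : ∀ z, ‖f z‖ ≤ C) : MemHardyDisc f ∧ ∑' k, ‖taylorCoeff f k‖ ^ 2 ≤ C ^ 2 := by
  have hC : 0 ≤ C := (norm_nonneg _).trans (h ⟨0, by simp⟩)
  refine memHardyDisc_of_lintegral_le hf (by positivity) fun ρ h0 h1 => ?_
  have hle : ∀ θ, ‖zeroExt f (circleMap 0 ρ θ)‖ₑ ^ 2 ≤ ENNReal.ofReal (C ^ 2) := by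
    intro θ
    rw [ENNReal.ofReal_pow hC, ← ofReal_norm]
    gcongr
    have hm : circleMap 0 ρ θ ∈ openDisc := by simpa [abs_of_pos h0] using h1
    have := zeroExt_apply f ⟨_, hm⟩
    dsimp only at this
    rw [this]
    exact h _
  calc _ ≤ ∫⁻ _ in Set.Ioo (-Real.pi) Real.pi, ENNReal.ofReal (C ^ 2) := lintegral_mono hle
    _ = ENNReal.ofReal (2 * Real.pi * C ^ 2) := by
      rw [lintegral_const, Measure.restrict_apply_univ, Real.volume_Ioo,
        ← ENNReal.ofReal_mul (by positivity)]
      congr 1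
      ring

/-! ### Reproducing kernels in `ℓ²` -/

/-- The reproducing kernel `(z̄ᵏ)ₖ` of the Hardy space at `z`. -/
def discKernel (z : openDisc) : lp (fun _ : ℕ => ℂ) 2 :=
  ⟨fun k => (starRingEnd ℂ (z : ℂ)) ^ k, (memℓp_two_iff _).2 (by
    have hz : ‖(z : ℂ)‖ < 1 := mem_ball_zero_iff.1 z.2
    have : ‖(z : ℂ)‖ ^ 2 < 1 := by nlinarith [norm_nonneg (z : ℂ)]
    refine (summable_geometric_of_lt_one (by positivity) this).congr fun k => ?_
    rw [norm_pow, RCLike.norm_conj, ← pow_mul, ← pow_mul, mul_comm])⟩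

theorem hasSum_inner_discKernel (z : openDisc) (v : lp (fun _ : ℕ => ℂ) 2) :
    HasSum (fun k => v k * (z : ℂ) ^ k) (inner ℂ (discKernel z) v) := by
  have e : (fun k => v k * (z : ℂ) ^ k) = fun k => inner ℂ (discKernel z k) (v k) := by
    funext k
    simp [discKernel, RCLike.inner_apply]
  rw [e]
  exact lp.hasSum_inner _ _

theorem inner_discKernel_toLp (z : openDisc) (f : HardyDisc) :
    inner ℂ (discKernel z) f.toLp = f.toFun z :=
  (hasSum_inner_discKernel z f.toLp).unique (hasSum_taylorCoeff f.mem.1 z)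

theorem inner_discKernel_discKernel (z a : openDisc) :
    inner ℂ (discKernel z) (discKernel a) = (1 - starRingEnd ℂ (a : ℂ) * z)⁻¹ := by
  refine (hasSum_inner_discKernel z _).unique ?_
  have hz : ‖(z : ℂ)‖ < 1 := mem_ball_zero_iff.1 z.2
  have ha : ‖(a : ℂ)‖ < 1 := mem_ball_zero_iff.1 a.2
  have h : ‖starRingEnd ℂ (a : ℂ) * z‖ < 1 := by
    rw [norm_mul, RCLike.norm_conj]
    nlinarith [norm_nonneg (z : ℂ), norm_nonneg (a : ℂ)]
  simpa [discKernel, mul_pow] using hasSum_geometric_of_norm_lt_one h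

open Filter Topology in
/-- A vector orthogonal to the kernels at all points of `(0, 1)` is zero. -/
theorem eq_zero_of_inner_discKernel {v : lp (fun _ : ℕ => ℂ) 2}
    (h : ∀ z : openDisc, (∃ a : ℝ, 0 < a ∧ (z : ℂ) = a) → inner ℂ (discKernel z) v = 0) :
    v = 0 := by
  set F : ℂ → ℂ := zeroExt fun z : openDisc => inner ℂ (discKernel z) v with hF
  have hFz : ∀ z : openDisc, F z = inner ℂ (discKernel z) v := fun z => zeroExt_apply _ z
  set p := FormalMultilinearSeries.ofScalars ℂ (fun k => v k) with hp
  have hs : HasFPowerSeriesOnBall F p 0 1 := by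
    refine ⟨?_, one_pos, fun {y} hy => ?_⟩
    · have := p.le_radius_of_bound ‖v‖ (r := 1) (fun n => by
        rw [hp, FormalMultilinearSeries.ofScalars_norm]
        simpa using lp.norm_apply_le_norm (by norm_num) v n)
      simpa using this
    · have hy' : y ∈ openDisc := by
        rw [Metric.mem_eball, edist_zero_right, ← ofReal_norm, ENNReal.ofReal_lt_one] at hy
        simpa using hy
      rw [zero_add, hFz ⟨y, hy'⟩]
      simpa [hp, FormalMultilinearSeries.ofScalars_apply_eq, mul_comm] using
        hasSum_inner_discKernel ⟨y, hy'⟩ v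
  have hfr : ∃ᶠ z in 𝓝[≠] (0 : ℂ), F z = 0 := by
    -- Halving keeps the point for `n = 0` inside the disc.
    have ht : Tendsto (fun n : ℕ => (((1 / ((n : ℝ) + 1) : ℝ)) : ℂ) / 2) atTop (𝓝[≠] 0) := by
      refine tendsto_nhdsWithin_iff.2 ⟨?_, Eventually.of_forall fun n => ?_⟩
      · have := ((Complex.continuous_ofReal.tendsto _).comp
          (tendsto_one_div_add_atTop_nhds_zero_nat (𝕜 := ℝ))).div_const 2
        simpa using this
      · have : ((1 / ((n : ℝ) + 1) : ℝ) : ℂ) ≠ 0 := by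
          rw [Complex.ofReal_ne_zero]
          positivity
        simpa using this
    refine ht.frequently (Frequently.of_forall fun n => ?_)
    have hn : 1 / ((n : ℝ) + 1) ≤ 1 := by
      rw [div_le_one (by positivity)]
      linarith [n.cast_nonneg (α := ℝ)]
    have hn0 : 0 < 1 / ((n : ℝ) + 1) := by positivity
    have hm : (((1 / ((n : ℝ) + 1) : ℝ)) : ℂ) / 2 ∈ openDisc := by
      rw [mem_ball_zero_iff, norm_div, Complex.norm_real, Real.norm_of_nonneg hn0.le]
      norm_num at hn ⊢
      linarith
    rw [hFz ⟨_, hm⟩]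
    exact h _ ⟨1 / ((n : ℝ) + 1) / 2, by positivity, by push_cast; rfl⟩
  have hp0 : p = 0 := hs.hasFPowerSeriesAt.locally_zero_iff.1
    (hs.analyticAt.frequently_zero_iff_eventually_zero.1 hfr)
  refine lp.ext (funext fun k => ?_)
  have := FormalMultilinearSeries.ofScalars_norm ℂ (fun k => v k) k
  rw [← hp, hp0] at this
  simpa using this.symm

/-! ### The powers of the singular inner function -/

theorem re_sub_one_div_add_one_nonpos {z : ℂ} (hz : z ∈ openDisc) :
    ((z - 1) / (z + 1)).re ≤ 0 := by
  have hz : ‖z‖ < 1 := by simpa using hz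
  have h2 : Complex.normSq z < 1 := by
    rw [Complex.normSq_eq_norm_sq]
    nlinarith [norm_nonneg z]
  rw [Complex.div_re, ← add_div]
  refine div_nonpos_of_nonpos_of_nonneg ?_ (Complex.normSq_nonneg _)
  rw [Complex.normSq_apply] at h2
  simp
  nlinarith

theorem add_one_ne_zero_of_mem_openDisc {z : ℂ} (hz : z ∈ openDisc) : z + 1 ≠ 0 := by
  intro h
  rw [eq_neg_of_add_eq_zero_left h] at hz
  simp at hz

theorem differentiableOn_singularPow (t : ℝ) :
    DifferentiableOn ℂ (fun z : ℂ => Complex.exp ((t : ℂ) * ((z - 1) / (z + 1)))) openDisc := by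
  refine ((DifferentiableOn.div (by fun_prop) (by fun_prop) fun z hz =>
    add_one_ne_zero_of_mem_openDisc hz).const_mul _).cexp

theorem isHolo_singularPow (t : ℝ) : IsHolo (singularPow t) :=
  isHolo_of_differentiableOn (differentiableOn_singularPow t)

theorem norm_singularPow_le {t : ℝ} (ht : 0 ≤ t) (z : openDisc) : ‖singularPow t z‖ ≤ 1 := by
  rw [singularPow, Complex.norm_exp, Complex.re_ofReal_mul, Real.exp_le_one_iff]
  exact mul_nonpos_of_nonneg_of_nonpos ht (re_sub_one_div_add_one_nonpos z.2)

theorem memHardyDisc_singularPow {t : ℝ} (ht : 0 ≤ t) : MemHardyDisc (singularPow t) :=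
  (memHardyDisc_of_norm_le (isHolo_singularPow t) (norm_singularPow_le ht)).1

/-- `φ^t` as an element of the Hardy space. -/
def singularElt (t : NNReal) : HardyDisc :=
  (⟨singularPow t, memHardyDisc_singularPow t.2⟩ : hardyDiscSubmodule)

theorem toFun_singularElt (t : NNReal) : (singularElt t).toFun = singularPow t := rfl

theorem norm_singularElt_le (t : NNReal) : ‖(singularElt t).toLp‖ ≤ 1 := by
  rw [HardyDisc.norm_toLp, HardyDisc.norm_def, Real.sqrt_le_one]
  simpa [toFun_singularElt] using
    (memHardyDisc_of_norm_le (isHolo_singularPow t) (norm_singularPow_le t.2)).2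

/-- Mean value inequality: the closed left half-plane is convex and `|exp'| ≤ 1` on it. -/
theorem norm_exp_sub_exp_le {z w : ℂ} (hz : z.re ≤ 0) (hw : w.re ≤ 0) :
    ‖Complex.exp z - Complex.exp w‖ ≤ ‖z - w‖ := by
  have hconv : Convex ℝ {z : ℂ | z.re ≤ 0} := convex_halfSpace_re_le 0
  have := hconv.norm_image_sub_le_of_norm_deriv_le (f := Complex.exp) (C := 1) (x := w) (y := z)
    (fun x _ => Complex.differentiableAt_exp) (fun x hx => by
      rw [Complex.deriv_exp, Complex.norm_exp, Real.exp_le_one_iff]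
      exact hx) hw hz
  simpa using this

/-- Cauchy's estimate on `|z| = 1/2`, whence `2 ^ k`; there `|(z - 1) / (z + 1)| ≤ (3/2) / (1/2) =
3`. -/
theorem norm_taylorCoeff_singularPow_sub_le (t s : NNReal) (k : ℕ) :
    ‖taylorCoeff (singularPow t) k - taylorCoeff (singularPow s) k‖ ≤
      3 * 2 ^ k * |(t : ℝ) - s| := by
  have hs := (isHolo_singularPow s).smul (-1)
  have e : taylorCoeff (singularPow t) k - taylorCoeff (singularPow s) k =
      taylorCoeff (singularPow t + (-1 : ℂ) • singularPow s) k := by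
    rw [taylorCoeff_add (isHolo_singularPow t) hs, taylorCoeff_smul _ (isHolo_singularPow s)]
    ring
  set g := singularPow t + (-1 : ℂ) • singularPow s with hg
  have hd : DifferentiableOn ℂ (zeroExt g) openDisc := (isHolo_singularPow t).add hs
  have hsub : Metric.closedBall (0 : ℂ) (1 / 2) ⊆ openDisc :=
    Metric.closedBall_subset_ball (by norm_num)
  have hD : DiffContOnCl ℂ (zeroExt g) (Metric.ball 0 (1 / 2)) :=
    (hd.mono hsub).diffContOnCl_ball subset_rfl
  have hb : ∀ z ∈ Metric.sphere (0 : ℂ) (1 / 2), ‖zeroExt g z‖ ≤ 3 * |(t : ℝ) - s| := by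
    intro z hz
    have hz1 : z ∈ openDisc := hsub (Metric.sphere_subset_closedBall hz)
    have hnz : ‖z‖ = 1 / 2 := by simpa using hz
    have := zeroExt_apply g ⟨z, hz1⟩
    dsimp only at this
    rw [this]
    have hre := re_sub_one_div_add_one_nonpos hz1
    have h1 : ‖g ⟨z, hz1⟩‖ = ‖Complex.exp ((t : ℝ) * ((z - 1) / (z + 1))) -
        Complex.exp ((s : ℝ) * ((z - 1) / (z + 1)))‖ := by
      simp [hg, singularPow, sub_eq_add_neg]
    rw [h1]
    refine (norm_exp_sub_exp_le ?_ ?_).trans ?_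
    · rw [Complex.re_ofReal_mul]
      exact mul_nonpos_of_nonneg_of_nonpos t.2 hre
    · rw [Complex.re_ofReal_mul]
      exact mul_nonpos_of_nonneg_of_nonpos s.2 hre
    · rw [← sub_mul, ← Complex.ofReal_sub, norm_mul, Complex.norm_real, Real.norm_eq_abs, mul_comm]
      refine mul_le_mul_of_nonneg_right ?_ (abs_nonneg _)
      rw [norm_div, div_le_iff₀ (norm_pos_iff.2 (add_one_ne_zero_of_mem_openDisc hz1))]
      have h2 : ‖z - 1‖ ≤ 3 / 2 := by
        refine (norm_sub_le _ _).trans ?_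
        rw [hnz, norm_one]; norm_num
      have h3 : 1 / 2 ≤ ‖z + 1‖ := by
        have := norm_sub_norm_le (1 : ℂ) (-z)
        rw [norm_one, norm_neg, hnz, sub_neg_eq_add, add_comm (1 : ℂ)] at this
        linarith
      linarith
  have := Complex.norm_iteratedDeriv_le_of_forall_mem_sphere_norm_le k (by norm_num) hD hb
  rw [e, taylorCoeff, norm_div, Complex.norm_natCast, div_le_iff₀ (by positivity)]
  refine this.trans (le_of_eq ?_)
  rw [one_div, inv_pow, div_inv_eq_mul]
  ring

theorem continuous_taylorCoeff_singularPow (k : ℕ) :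
    Continuous fun t : NNReal => taylorCoeff (singularPow t) k := by
  refine LipschitzWith.continuous (K := 3 * 2 ^ k) (LipschitzWith.of_dist_le_mul fun t s => ?_)
  rw [dist_eq_norm, NNReal.dist_eq]
  exact norm_taylorCoeff_singularPow_sub_le t s k

-- Norm continuity in `t` is not needed for the Bochner integral: each coordinate is continuous, and
-- the vector is the pointwise limit of its finite truncations.
open Filter Topology in
theorem stronglyMeasurable_singularElt :
    StronglyMeasurable fun t : ℝ => (singularElt t.toNNReal).toLp := by
  refine stronglyMeasurable_of_tendsto (u := atTop)
    (f := fun (N : ℕ) (t : ℝ) => ∑ k ∈ Finset.range N,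
      lp.single 2 k (taylorCoeff (singularPow t.toNNReal) k)) (fun N => ?_) ?_
  · refine Continuous.stronglyMeasurable (continuous_finsetSum _ fun k _ => ?_)
    have : ∀ c : ℂ, lp.single (E := fun _ : ℕ => ℂ) 2 k c = c • lp.single 2 k (1 : ℂ) := by
      intro c
      rw [← lp.single_smul]
      simp
    have h1 : Continuous fun t : ℝ => taylorCoeff (singularPow t.toNNReal) k :=
      (continuous_taylorCoeff_singularPow k).comp continuous_real_toNNReal
    refine (h1.smul (continuous_const (y := lp.single (E := fun _ : ℕ => ℂ) 2 k (1 : ℂ)))).congr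
      fun t => (this _).symm
  · refine tendsto_pi_nhds.2 fun t => ?_
    exact (lp.hasSum_single (by norm_num) (singularElt t.toNNReal).toLp).tendsto_sum_nat

theorem integrableOn_singularElt {w : ℝ} (hw : 0 < w) :
    IntegrableOn (fun t : ℝ => (Real.exp (-w * t) : ℂ) • (singularElt t.toNNReal).toLp)
      (Set.Ioi 0) := by
  refine (exp_neg_integrableOn_Ioi 0 hw).mono' ?_ (Filter.Eventually.of_forall fun t => ?_)
  · refine StronglyMeasurable.aestronglyMeasurable ?_
    have h : Continuous fun t : ℝ => (Real.exp (-w * t) : ℂ) := by fun_prop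
    exact h.stronglyMeasurable.smul stronglyMeasurable_singularElt
  · rw [norm_smul, Complex.norm_real, Real.norm_of_nonneg (Real.exp_pos _).le]
    exact mul_le_of_le_one_right (Real.exp_pos _).le (norm_singularElt_le _)

/-- The Laplace transform of `t ↦ φ^t`. -/
theorem integral_exp_smul_singularElt {w : ℝ} (hw : 0 < w) (z : openDisc) :
    inner ℂ (discKernel z)
      (∫ t in Set.Ioi (0 : ℝ), (Real.exp (-w * t) : ℂ) • (singularElt t.toNNReal).toLp) =
      ((z : ℂ) + 1) / ((w + 1) + (w - 1) * z) := by
  rw [← integral_inner (integrableOn_singularElt hw)]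
  have hz := add_one_ne_zero_of_mem_openDisc z.2
  have hre := re_sub_one_div_add_one_nonpos z.2
  have ha : (-(w : ℂ) + ((z : ℂ) - 1) / (z + 1)).re < 0 := by
    rw [Complex.add_re, Complex.neg_re, Complex.ofReal_re]
    linarith
  have e : ∀ t ∈ Set.Ioi (0 : ℝ), inner ℂ (discKernel z)
      ((Real.exp (-w * t) : ℂ) • (singularElt t.toNNReal).toLp) =
      Complex.exp ((-(w : ℂ) + ((z : ℂ) - 1) / (z + 1)) * t) := by
    intro t ht
    rw [inner_smul_right, inner_discKernel_toLp, toFun_singularElt, singularPow,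
      Real.coe_toNNReal _ (le_of_lt ht), Complex.ofReal_exp, ← Complex.exp_add]
    congr 1
    push_cast
    ring
  rw [setIntegral_congr_fun measurableSet_Ioi e, integral_exp_mul_complex_Ioi ha]
  have hne : -(w : ℂ) + ((z : ℂ) - 1) / (z + 1) ≠ 0 := fun h => by
    rw [h] at ha
    simp at ha
  have hne2 : ((w : ℂ) + 1) + (w - 1) * z ≠ 0 := by
    intro h
    apply hne
    field_simp
    linear_combination -h
  simp only [Complex.ofReal_zero, mul_zero, Complex.exp_zero]
  rw [div_eq_div_iff hne hne2]
  field_simp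
  ring

/-- The Laplace transform of `t ↦ φ^t` at `(1 - a) / (1 + a)` is a combination of kernels. -/
theorem integral_exp_smul_singularElt_eq {a : openDisc} {r : ℝ} (hr : 0 < r) (ha : (a : ℂ) = r) :
    ∃ α β : ℂ, β ≠ 0 ∧
      ∫ t in Set.Ioi (0 : ℝ), (Real.exp (-((1 - r) / (1 + r)) * t) : ℂ) •
        (singularElt t.toNNReal).toLp =
      α • (singularElt 0).toLp + β • discKernel a := by
  have hr1 : r < 1 := by
    have := a.2
    rw [mem_ball_zero_iff, ha, Complex.norm_real, Real.norm_of_nonneg hr.le] at this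
    exact this
  have hw : 0 < (1 - r) / (1 + r) := div_pos (by linarith) (by linarith)
  have hrc : (r : ℂ) ≠ 0 := by exact_mod_cast hr.ne'
  have hr2 : (1 + r : ℂ) ≠ 0 := by
    have : (1 + r : ℝ) ≠ 0 := by positivity
    exact_mod_cast this
  -- Partial fractions of the Laplace transform, which for this `w` is `(1 + r) (z + 1) / (2 (1 - r
  -- z))`.
  refine ⟨-((1 + r) / (2 * r)), (1 + r) / (2 * r) * (1 + r), ?_, ?_⟩
  · exact mul_ne_zero (div_ne_zero hr2 (by simpa using hrc)) hr2
  rw [← sub_eq_zero]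
  refine eq_zero_of_inner_discKernel fun z _ => ?_
  rw [inner_sub_right, integral_exp_smul_singularElt hw, inner_add_right, inner_smul_right,
    inner_smul_right, inner_discKernel_toLp, inner_discKernel_discKernel, toFun_singularElt,
    singularPow, ha, Complex.conj_ofReal]
  have hz : ‖(z : ℂ)‖ < 1 := mem_ball_zero_iff.1 z.2
  have hne : 1 - (r : ℂ) * z ≠ 0 := by
    intro h
    have h2 : ‖(r : ℂ) * z‖ = 1 := by rw [← sub_eq_zero.1 h, norm_one]
    rw [norm_mul, Complex.norm_real, Real.norm_of_nonneg hr.le] at h2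
    nlinarith [norm_nonneg (z : ℂ)]
  have e : ((((1 - r) / (1 + r) : ℝ) : ℂ) + 1) + ((((1 - r) / (1 + r) : ℝ) : ℂ) - 1) * z =
      2 * (1 - r * z) / (1 + r) := by
    push_cast
    field_simp
    ring
  rw [e]
  simp only [NNReal.coe_zero, Complex.ofReal_zero, zero_mul, Complex.exp_zero]
  set D := 1 - (r : ℂ) * z with hD
  field_simp
  rw [hD]
  ring

/-- The powers of `φ` span a dense subspace of `ℓ²`. -/
theorem topologicalClosure_span_singularElt :
    (Submodule.span ℂ (Set.range fun t : NNReal => (singularElt t).toLp)).topologicalClosure =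
      ⊤ := by
  rw [Submodule.topologicalClosure_eq_top_iff, Submodule.eq_bot_iff]
  intro g hg
  have h0 : ∀ t, inner ℂ g (singularElt t).toLp = 0 := fun t =>
    (Submodule.mem_orthogonal' _ _).1 hg _ (Submodule.subset_span ⟨t, rfl⟩)
  refine eq_zero_of_inner_discKernel fun a ⟨r, hr, ha⟩ => ?_
  obtain ⟨α, β, hβ, h⟩ := integral_exp_smul_singularElt_eq hr ha
  have hr1 : r < 1 := by
    have := a.2
    rw [mem_ball_zero_iff, ha, Complex.norm_real, Real.norm_of_nonneg hr.le] at this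
    exact this
  have hw : 0 < (1 - r) / (1 + r) := div_pos (by linarith) (by linarith)
  -- The inner product passes under the integral, so `g` is orthogonal to the Laplace transform as
  -- well.
  have h1 := integral_inner (𝕜 := ℂ) (integrableOn_singularElt hw) g
  simp only [inner_smul_right, h0, mul_zero, integral_zero] at h1
  rw [h, inner_add_right, inner_smul_right, inner_smul_right, h0, mul_zero, zero_add] at h1
  rw [← inner_conj_symm, (mul_eq_zero.1 h1.symm).resolve_left hβ, map_zero]

/-- The map to Taylor coefficients as a linear isometry. -/
def HardyDisc.toLpₗᵢ : HardyDisc →ₗᵢ[ℂ] lp (fun _ : ℕ => ℂ) 2 where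
  toFun := HardyDisc.toLp
  map_add' := HardyDisc.toLp_add
  map_smul' := HardyDisc.toLp_smul
  norm_map' := HardyDisc.norm_toLp

theorem topologicalClosure_span_singularPow :
    (Submodule.span ℂ
      {f : HardyDisc | ∃ t : ℝ, 0 ≤ t ∧ f.toFun = singularPow t}).topologicalClosure = ⊤ := by
  have hS : {f : HardyDisc | ∃ t : ℝ, 0 ≤ t ∧ f.toFun = singularPow t} =
      Set.range singularElt := by
    ext f
    constructor
    · rintro ⟨t, ht, hf⟩
      exact ⟨⟨t, ht⟩, HardyDisc.toFun_injective hf.symm⟩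
    · rintro ⟨t, rfl⟩
      exact ⟨t, t.2, rfl⟩
  rw [hS, Submodule.eq_top_iff']
  intro f
  have h := topologicalClosure_span_singularElt
  have hr : (Set.range fun t : NNReal => (singularElt t).toLp) =
      HardyDisc.toLpₗᵢ.toLinearMap '' Set.range singularElt := by
    rw [← Set.range_comp]
    rfl
  rw [hr, Submodule.span_image] at h
  have hf : HardyDisc.toLpₗᵢ f ∈
      closure (HardyDisc.toLpₗᵢ '' (Submodule.span ℂ (Set.range singularElt) : Set HardyDisc)) := by
    have : HardyDisc.toLpₗᵢ f ∈ (⊤ : Submodule ℂ (lp (fun _ : ℕ => ℂ) 2)) := trivial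
    rw [← h] at this
    exact this
  -- Closures pull back along an isometric embedding, so neither completeness of the Hardy space nor
  -- surjectivity onto `ℓ²` is used.
  rwa [← Set.mem_preimage,
    ← HardyDisc.toLpₗᵢ.isometry.isEmbedding.isInducing.closure_eq_preimage_closure_image] at hf

/-! ### Vertical lines and circles -/

-- Fatou's lemma, in the form in which uniform bounds pass to a pointwise limit.
open Filter Topology in
theorem lintegral_le_of_tendsto_of_le {α : Type*} [MeasurableSpace α] {μ : Measure α}
    {F : ℕ → α → ℝ≥0∞} {f : α → ℝ≥0∞} {C : ℝ≥0∞} (hF : ∀ n, Measurable (F n))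
    (hlim : ∀ᵐ x ∂μ, Tendsto (fun n => F n x) atTop (𝓝 (f x))) (hC : ∀ n, ∫⁻ x, F n x ∂μ ≤ C) :
    ∫⁻ x, f x ∂μ ≤ C := by
  calc ∫⁻ x, f x ∂μ = ∫⁻ x, liminf (fun n => F n x) atTop ∂μ :=
        lintegral_congr_ae (hlim.mono fun x hx => hx.liminf_eq.symm)
    _ ≤ liminf (fun n => ∫⁻ x, F n x ∂μ) atTop := lintegral_liminf_le hF
    _ ≤ C := liminf_le_of_frequently_le' (Frequently.of_forall hC)

theorem circleMap_neg_two_arctan (u : ℝ) :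
    circleMap 0 1 (-2 * Real.arctan u) = (1 - u * Complex.I) / (1 + u * Complex.I) := by
  have hne : (1 + u * Complex.I : ℂ) ≠ 0 := by
    intro h
    have := congrArg Complex.re h
    simp at this
  have hs : (0 : ℝ) < 1 + u ^ 2 := by positivity
  have h1 : Complex.exp (-(Real.arctan u : ℂ) * Complex.I) =
      (1 - u * Complex.I) / (Real.sqrt (1 + u ^ 2) : ℂ) := by
    rw [Complex.exp_mul_I, Complex.cos_neg, Complex.sin_neg, ← Complex.ofReal_cos,
      ← Complex.ofReal_sin, Real.cos_arctan, Real.sin_arctan]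
    push_cast
    ring
  have h2 : (Real.sqrt (1 + u ^ 2) : ℂ) ^ 2 = (1 - u * Complex.I) * (1 + u * Complex.I) := by
    rw [← Complex.ofReal_pow, Real.sq_sqrt hs.le]
    push_cast
    linear_combination (u : ℂ) ^ 2 * Complex.I_sq
  rw [circleMap_zero, Complex.ofReal_one, one_mul,
    show ((-2 * Real.arctan u : ℝ) : ℂ) * Complex.I = (2 : ℕ) * (-(Real.arctan u : ℂ) * Complex.I)
      by push_cast; ring, Complex.exp_nat_mul, h1, div_pow, h2]
  have hne2 : (1 - u * Complex.I : ℂ) ≠ 0 := by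
    intro h
    have := congrArg Complex.re h
    simp at this
  field_simp

theorem image_neg_two_arctan {A : ℝ} (hA : 0 < A) :
    (fun y : ℝ => -2 * Real.arctan (y / A)) '' Set.univ = Set.Ioo (-Real.pi) Real.pi := by
  ext θ
  constructor
  · rintro ⟨y, -, rfl⟩
    have h1 := Real.neg_pi_div_two_lt_arctan (y / A)
    have h2 := Real.arctan_lt_pi_div_two (y / A)
    constructor <;> dsimp only <;> linarith
  · rintro ⟨h1, h2⟩
    refine ⟨A * Real.tan (-θ / 2), trivial, ?_⟩
    dsimp only
    rw [mul_div_cancel_left₀ _ hA.ne', Real.arctan_tan (by linarith) (by linarith)]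
    ring

/-- Substitute `θ = -2 arctan (y / A)`, which maps the line bijectively onto `(-π, π)`; the weight
is the absolute value of its derivative. -/
theorem lintegral_circle_eq_lintegral_line {A : ℝ} (hA : 0 < A) (h : ℂ → ℝ≥0∞) :
    ∫⁻ θ in Set.Ioo (-Real.pi) Real.pi, h (circleMap 0 1 θ) =
      ∫⁻ y : ℝ, ENNReal.ofReal (2 * A / (A ^ 2 + y ^ 2)) *
        h ((A - y * Complex.I) / (A + y * Complex.I)) := by
  have hd : ∀ y ∈ Set.univ, HasDerivWithinAt (fun y : ℝ => -2 * Real.arctan (y / A))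
      (-(2 * A / (A ^ 2 + y ^ 2))) Set.univ y := by
    intro y _
    have h1 := ((((hasDerivAt_id y).div_const A).arctan).const_mul (-2)).hasDerivWithinAt
      (s := Set.univ)
    refine h1.congr_deriv ?_
    simp only [id]
    field_simp
  have hinj : Set.InjOn (fun y : ℝ => -2 * Real.arctan (y / A)) Set.univ := by
    intro y _ y' _ hy
    have := Real.arctan_injective (mul_left_cancel₀ (by norm_num) hy)
    exact (div_left_inj' hA.ne').1 this
  have := lintegral_image_eq_lintegral_abs_deriv_mul MeasurableSet.univ hd hinj
    (fun θ => h (circleMap 0 1 θ))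
  rw [image_neg_two_arctan hA] at this
  rw [this, setLIntegral_univ]
  refine lintegral_congr fun y => ?_
  rw [abs_neg, abs_of_pos (by positivity), circleMap_neg_two_arctan]
  congr 2
  have hA' : (A : ℂ) ≠ 0 := by exact_mod_cast hA.ne'
  push_cast
  rw [← mul_div_mul_left _ _ hA']
  congr 1 <;> field_simp

/-- The integral over a vertical line as an integral over a circle tangent to the unit circle. -/
theorem lintegral_line_cayley {x : ℝ} (hx : 0 < x) (f : ℂ → ℂ) :
    ∫⁻ y : ℝ, ‖f ((1 - (x + y * Complex.I)) / (1 + (x + y * Complex.I))) /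
        (1 + (x + y * Complex.I))‖ₑ ^ 2 =
      ENNReal.ofReal ((1 + x)⁻¹ / 2) * ∫⁻ θ in Set.Ioo (-Real.pi) Real.pi,
        ‖f (((1 + x)⁻¹ : ℝ) - 1 + ((1 + x)⁻¹ : ℝ) * circleMap 0 1 θ)‖ₑ ^ 2 := by
  have hA : 0 < 1 + x := by linarith
  rw [lintegral_circle_eq_lintegral_line hA
    (fun ζ => ‖f (((1 + x)⁻¹ : ℝ) - 1 + ((1 + x)⁻¹ : ℝ) * ζ)‖ₑ ^ 2),
    ← lintegral_const_mul' _ _ ENNReal.ofReal_ne_top]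
  refine lintegral_congr fun y => ?_
  have hAc : (1 + x : ℂ) ≠ 0 := by exact_mod_cast hA.ne'
  have hne : (1 + x + y * Complex.I : ℂ) ≠ 0 := by
    intro h
    have := congrArg Complex.re h
    simp at this
    linarith
  have e1 : ((1 + x)⁻¹ : ℝ) - 1 + ((1 + x)⁻¹ : ℝ) *
      ((((1 + x : ℝ) : ℂ) - y * Complex.I) / (((1 + x : ℝ) : ℂ) + y * Complex.I)) =
      (1 - (x + y * Complex.I)) / (1 + (x + y * Complex.I)) := by
    push_cast
    rw [← add_assoc]
    field_simp
    ring
  have e2 : ‖(1 + (x + y * Complex.I) : ℂ)‖ ^ 2 = (1 + x) ^ 2 + y ^ 2 := by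
    rw [← Complex.normSq_eq_norm_sq, Complex.normSq_apply]
    simp
    ring
  rw [e1, ← mul_assoc, ← ENNReal.ofReal_mul (by positivity), div_eq_mul_inv, enorm_mul, mul_pow,
    mul_comm]
  congr 1
  rw [← ofReal_norm, ← ENNReal.ofReal_pow (norm_nonneg _), norm_inv, inv_pow, e2]
  congr 1
  field_simp

/-- For `0 < r < 1` this shows that the tangent circle meets the unit circle only where `cos θ =
-1`. -/
theorem norm_sq_affine_circleMap (r θ : ℝ) :
    ‖(r - 1 + r * circleMap 0 1 θ : ℂ)‖ ^ 2 = 1 - 2 * r * (1 - r) * (1 + Real.cos θ) := by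
  rw [← Complex.normSq_eq_norm_sq, Complex.normSq_apply, circleMap_zero]
  simp [Complex.exp_ofReal_mul_I_re, Complex.exp_ofReal_mul_I_im]
  linear_combination r ^ 2 * Real.sin_sq_add_cos_sq θ

theorem one_add_cos_pos {θ : ℝ} (hθ : θ ∈ Set.Ioo (-Real.pi) Real.pi) : 0 < 1 + Real.cos θ := by
  have h := Real.cos_pos_of_mem_Ioo (x := θ / 2) ⟨by linarith [hθ.1], by linarith [hθ.2]⟩
  have := Real.cos_sq (θ / 2)
  rw [mul_div_cancel₀ θ two_ne_zero] at this
  nlinarith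

theorem affine_circleMap_mem_openDisc {r θ : ℝ} (h0 : 0 < r) (h1 : r < 1)
    (hθ : θ ∈ Set.Ioo (-Real.pi) Real.pi) : (r - 1 + r * circleMap 0 1 θ : ℂ) ∈ openDisc := by
  have h := norm_sq_affine_circleMap r θ
  have h2 : 0 < 2 * r * (1 - r) * (1 + Real.cos θ) :=
    mul_pos (by nlinarith) (one_add_cos_pos hθ)
  rw [mem_ball_zero_iff]
  nlinarith [norm_nonneg (r - 1 + r * circleMap 0 1 θ : ℂ)]

/-! ### Affine substitutions act boundedly on the Hardy space -/

/-- One of the two Schur sums: the negative binomial series `∑ (m + k choose k) q ^ m = (1 - q)⁻¹ ^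
(k + 1)` at `q = 1 - r`. -/
theorem sum_range_choose_mul_pow_le {r : ℝ} (h0 : 0 < r) (h1 : r < 1) (N k : ℕ) :
    ∑ n ∈ Finset.range N, r ^ k * (1 - r) ^ (n - k) * (n.choose k) ≤ r⁻¹ := by
  have hq : ‖1 - r‖ < 1 := by rw [Real.norm_of_nonneg (by linarith)]; linarith
  have hq0 : 0 ≤ 1 - r := by linarith
  have hs := hasSum_choose_mul_geometric_of_norm_lt_one k hq
  calc ∑ n ∈ Finset.range N, r ^ k * (1 - r) ^ (n - k) * (n.choose k)
      ≤ ∑ n ∈ Finset.range (k + N), r ^ k * (1 - r) ^ (n - k) * (n.choose k) := by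
        refine Finset.sum_le_sum_of_subset_of_nonneg
          (Finset.range_subset_range.2 (by omega)) fun _ _ _ => by positivity
    _ = ∑ m ∈ Finset.range N, r ^ k * (((m + k).choose k) * (1 - r) ^ m) := by
        rw [Finset.sum_range_add, Finset.sum_eq_zero, zero_add]
        · refine Finset.sum_congr rfl fun m _ => ?_
          rw [Nat.add_sub_cancel_left, add_comm k m]
          ring
        · intro n hn
          rw [Nat.choose_eq_zero_of_lt (Finset.mem_range.1 hn)]
          simp
    _ = r ^ k * ∑ m ∈ Finset.range N, ((m + k).choose k) * (1 - r) ^ m := by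
        rw [Finset.mul_sum]
    _ ≤ r ^ k * (1 / (1 - (1 - r)) ^ (k + 1)) := by
        refine mul_le_mul_of_nonneg_left ?_ (by positivity)
        exact sum_le_hasSum _ (fun _ _ => by positivity) hs
    _ = r⁻¹ := by
        rw [sub_sub_cancel, pow_succ]
        field_simp

/-- The other Schur sum: the binomial expansion of `(r + (1 - r)) ^ n`. -/
theorem sum_range_choose_mul_pow_eq_one {r : ℝ} {N n : ℕ} (hn : n < N) :
    ∑ k ∈ Finset.range N, r ^ k * (1 - r) ^ (n - k) * (n.choose k) = 1 := by
  have h := add_pow r (1 - r) n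
  rw [add_sub_cancel, one_pow] at h
  have hsub : Finset.range (n + 1) ⊆ Finset.range N := Finset.range_subset_range.2 hn
  refine (Finset.sum_subset hsub fun k _ hk => ?_).symm.trans h.symm
  rw [Nat.choose_eq_zero_of_lt (by simpa using hk)]
  simp

/-- Re-expansion of a polynomial after an affine substitution, with the Schur bound. -/
theorem exists_affine_coeff {r : ℝ} (h0 : 0 < r) (h1 : r < 1) (a : ℕ → ℂ) (N : ℕ) :
    ∃ b : ℕ → ℂ, (∀ ζ : ℂ, ∑ n ∈ Finset.range N, a n * (r - 1 + r * ζ) ^ n =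
      ∑ k ∈ Finset.range N, b k * ζ ^ k) ∧
      ∑ k ∈ Finset.range N, ‖b k‖ ^ 2 ≤ r⁻¹ * ∑ n ∈ Finset.range N, ‖a n‖ ^ 2 := by
  have hq0 : 0 ≤ 1 - r := by linarith
  set A : ℕ → ℕ → ℝ := fun n k => r ^ k * (1 - r) ^ (n - k) * (n.choose k) with hA
  have hA0 : ∀ n k, 0 ≤ A n k := fun n k => by simp only [hA]; positivity
  -- Binomial expansion of `(r ζ + (r - 1)) ^ n`. For `k > n` the truncated exponent `n - k` is
  -- harmless, as the binomial coefficient vanishes.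
  refine ⟨fun k => ∑ n ∈ Finset.range N, a n * (r ^ k * (r - 1) ^ (n - k) * (n.choose k)), ?_, ?_⟩
  · intro ζ
    have hz : ∀ n ∈ Finset.range N, a n * (r - 1 + r * ζ) ^ n = ∑ k ∈ Finset.range N,
        a n * (r ^ k * (r - 1) ^ (n - k) * (n.choose k)) * ζ ^ k := by
      intro n hn
      rw [add_comm, add_pow, Finset.mul_sum]
      have hsub : Finset.range (n + 1) ⊆ Finset.range N :=
        Finset.range_subset_range.2 (Finset.mem_range.1 hn)
      rw [← Finset.sum_subset hsub fun k _ hk => by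
        rw [Nat.choose_eq_zero_of_lt (by simpa using hk)]
        simp]
      exact Finset.sum_congr rfl fun k _ => by ring
    rw [Finset.sum_congr rfl hz, Finset.sum_comm]
    exact Finset.sum_congr rfl fun k _ => (Finset.sum_mul _ _ _).symm
  · have hb : ∀ k ∈ Finset.range N,
        ‖∑ n ∈ Finset.range N, a n * ((r : ℂ) ^ k * (r - 1) ^ (n - k) * (n.choose k))‖ ^ 2 ≤
        r⁻¹ * ∑ n ∈ Finset.range N, A n k * ‖a n‖ ^ 2 := by
      intro k _
      have hn1 : ‖(r : ℂ) - 1‖ = 1 - r := by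
        rw [← Complex.ofReal_one, ← Complex.ofReal_sub, Complex.norm_real, Real.norm_of_nonpos
          (by linarith)]
        ring
      have hle : ‖∑ n ∈ Finset.range N,
          a n * ((r : ℂ) ^ k * (r - 1) ^ (n - k) * (n.choose k))‖ ≤
          ∑ n ∈ Finset.range N, A n k * ‖a n‖ := by
        refine (norm_sum_le _ _).trans (le_of_eq (Finset.sum_congr rfl fun n _ => ?_))
        rw [norm_mul, norm_mul, norm_mul, norm_pow, norm_pow, hn1, Complex.norm_real,
          Real.norm_of_nonneg h0.le, Complex.norm_natCast, mul_comm]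
      -- Schur's test: Cauchy–Schwarz with the weights `A n k`, followed by the bound `r⁻¹` on their
      -- sum over `n`.
      calc _ ≤ (∑ n ∈ Finset.range N, A n k * ‖a n‖) ^ 2 := by gcongr
        _ ≤ (∑ n ∈ Finset.range N, A n k) * ∑ n ∈ Finset.range N, A n k * ‖a n‖ ^ 2 := by
          refine Finset.sum_sq_le_sum_mul_sum_of_sq_le_mul _ (fun n _ => hA0 n k)
            (fun n _ => mul_nonneg (hA0 n k) (by positivity)) fun n _ => le_of_eq (by ring)
        _ ≤ _ := by
          refine mul_le_mul_of_nonneg_right (sum_range_choose_mul_pow_le h0 h1 N k)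
            (Finset.sum_nonneg fun n _ => mul_nonneg (hA0 n k) (by positivity))
    refine (Finset.sum_le_sum hb).trans ?_
    rw [← Finset.mul_sum, Finset.sum_comm]
    refine mul_le_mul_of_nonneg_left (le_of_eq (Finset.sum_congr rfl fun n hn => ?_))
      (by positivity)
    rw [← Finset.sum_mul, sum_range_choose_mul_pow_eq_one (Finset.mem_range.1 hn), one_mul]

open Filter Topology in
/-- The quadratic integral over a circle internally tangent to the unit circle at `-1`. -/
theorem lintegral_tangent_circle_le {a : ℕ → ℂ} {f : ℂ → ℂ}
    (hf : ∀ z ∈ Metric.ball (0 : ℂ) 1, HasSum (fun k => a k * z ^ k) (f z))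
    (ha : Summable fun k => ‖a k‖ ^ 2) {r : ℝ} (h0 : 0 < r) (h1 : r < 1) :
    ∫⁻ θ in Set.Ioo (-Real.pi) Real.pi, ‖f (r - 1 + r * circleMap 0 1 θ)‖ₑ ^ 2 ≤
      ENNReal.ofReal (2 * Real.pi * (r⁻¹ * ∑' k, ‖a k‖ ^ 2)) := by
  refine lintegral_le_of_tendsto_of_le (F := fun N θ =>
    ‖∑ k ∈ Finset.range N, a k * (r - 1 + r * circleMap 0 1 θ) ^ k‖ₑ ^ 2) (fun N => ?_) ?_
    fun N => ?_
  · have : Continuous fun θ : ℝ =>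
        ∑ k ∈ Finset.range N, a k * (r - 1 + r * circleMap 0 1 θ) ^ k :=
      continuous_finsetSum _ fun k _ => continuous_const.mul
        ((continuous_const.add (continuous_const.mul (continuous_circleMap 0 1))).pow k)
    exact (this.measurable.enorm).pow_const 2
  · refine (ae_restrict_iff' measurableSet_Ioo).2 (Eventually.of_forall fun θ hθ => ?_)
    exact ((ENNReal.continuous_pow 2).tendsto _).comp ((continuous_enorm.tendsto _).comp
      (hf _ (affine_circleMap_mem_openDisc h0 h1 hθ)).tendsto_sum_nat)
  · obtain ⟨b, hb, hb2⟩ := exists_affine_coeff h0 h1 a N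
    simp_rw [hb]
    rw [lintegral_circle_sum_sq]
    refine ENNReal.ofReal_le_ofReal (mul_le_mul_of_nonneg_left (hb2.trans ?_) (by positivity))
    exact mul_le_mul_of_nonneg_left (ha.sum_le_tsum _ fun _ _ => by positivity) (by positivity)

/-! ### The transform from the disc to the half-plane -/

theorem one_add_ne_zero_of_re_pos {s : ℂ} (hs : s ∈ rightHalfPlane) : 1 + s ≠ 0 := by
  intro h
  have h1 := congrArg Complex.re h
  have h2 : 0 < s.re := hs
  simp at h1
  linarith

theorem cayley_mem_openDisc {s : ℂ} (hs : s ∈ rightHalfPlane) : (1 - s) / (1 + s) ∈ openDisc := by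
  have h2 : 0 < s.re := hs
  rw [mem_ball_zero_iff, norm_div,
    div_lt_one (norm_pos_iff.2 (one_add_ne_zero_of_re_pos hs))]
  refine lt_of_pow_lt_pow_left₀ 2 (norm_nonneg _) ?_
  rw [← Complex.normSq_eq_norm_sq, ← Complex.normSq_eq_norm_sq, Complex.normSq_apply,
    Complex.normSq_apply]
  simp
  nlinarith

/-- The transform `f ↦ f((1 - s) / (1 + s)) / (1 + s)` on functions. -/
def halfPlaneTransform (f : openDisc → ℂ) (s : rightHalfPlane) : ℂ :=
  zeroExt f ((1 - s) / (1 + s)) / (1 + s)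

theorem IsHolo.halfPlaneTransform {f : openDisc → ℂ} (hf : IsHolo f) :
    IsHolo (halfPlaneTransform f) := by
  refine isHolo_of_differentiableOn (g := fun s => zeroExt f ((1 - s) / (1 + s)) / (1 + s)) ?_
  have hd : DifferentiableOn ℂ (fun s : ℂ => (1 - s) / (1 + s)) rightHalfPlane :=
    DifferentiableOn.div (by fun_prop) (by fun_prop) fun s hs => one_add_ne_zero_of_re_pos hs
  exact (DifferentiableOn.comp hf hd fun s hs => cayley_mem_openDisc hs).div (by fun_prop)
    fun s hs => one_add_ne_zero_of_re_pos hs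

/-- The Jacobian factor `(1 + x)⁻¹ / 2` cancels the Schur constant `1 + x`, which makes the bound
uniform in `x`. -/
theorem halfPlaneNormSq_halfPlaneTransform_le {f : openDisc → ℂ} (hf : MemHardyDisc f) :
    halfPlaneNormSq (halfPlaneTransform f) ≤
      ENNReal.ofReal (Real.pi * ∑' k, ‖taylorCoeff f k‖ ^ 2) := by
  refine iSup_le fun ⟨x, hx⟩ => ?_
  have hA : 0 < 1 + x := by linarith
  have h1 := lintegral_line_cayley hx (zeroExt f)
  have h2 : ∀ y : ℝ, zeroExt (halfPlaneTransform f) ((x : ℂ) + (y : ℂ) * Complex.I) =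
      zeroExt f ((1 - (x + y * Complex.I)) / (1 + (x + y * Complex.I))) /
        (1 + (x + y * Complex.I)) := fun y =>
    zeroExt_apply (halfPlaneTransform f) ⟨_, by simpa using hx⟩
  simp_rw [h2]
  rw [h1]
  have h3 := lintegral_tangent_circle_le (hasSum_iteratedDeriv_div hf.1) hf.2
    (inv_pos.2 hA) (inv_lt_one_of_one_lt₀ (by linarith))
  refine (mul_le_mul_right h3 _).trans ?_
  rw [← ENNReal.ofReal_mul (by positivity), inv_inv]
  refine ENNReal.ofReal_le_ofReal (le_of_eq ?_)
  change _ = Real.pi * ∑' k : ℕ, ‖iteratedDeriv k (zeroExt f) 0 / (k.factorial : ℂ)‖ ^ 2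
  field_simp

theorem MemHardyDisc.halfPlaneTransform {f : openDisc → ℂ} (hf : MemHardyDisc f) :
    MemHardyHalfPlane (halfPlaneTransform f) :=
  ⟨hf.1.halfPlaneTransform,
    (halfPlaneNormSq_halfPlaneTransform_le hf).trans_lt ENNReal.ofReal_lt_top⟩

/-- The transform `f ↦ f((1 - s) / (1 + s)) / (1 + s)` as a bounded operator. -/
def hardyTransform : HardyDisc →L[ℂ] HardyHalfPlane :=
  LinearMap.mkContinuous
    { toFun := fun f => (⟨halfPlaneTransform f.toFun, f.mem.halfPlaneTransform⟩ :
        hardyHalfPlaneSubmodule)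
      map_add' := fun f g => HardyHalfPlane.toFun_injective (funext fun s => by
        change halfPlaneTransform (f.toFun + g.toFun) s =
          halfPlaneTransform f.toFun s + halfPlaneTransform g.toFun s
        simp only [halfPlaneTransform, zeroExt_add, Pi.add_apply, add_div])
      map_smul' := fun c f => HardyHalfPlane.toFun_injective (funext fun s => by
        change halfPlaneTransform (c • f.toFun) s = c * halfPlaneTransform f.toFun s
        simp only [halfPlaneTransform, zeroExt_smul, Pi.smul_apply, smul_eq_mul, mul_div_assoc]) }
    (Real.sqrt Real.pi) (fun f => by
      rw [HardyHalfPlane.norm_def, HardyDisc.norm_def, ← Real.sqrt_mul Real.pi_pos.le]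
      exact Real.sqrt_le_sqrt (ENNReal.toReal_le_of_le_ofReal
        (mul_nonneg Real.pi_pos.le (tsum_nonneg fun _ => by positivity))
        (halfPlaneNormSq_halfPlaneTransform_le f.mem)))

theorem halfPlaneTransform_singularPow (t : ℝ) :
    halfPlaneTransform (singularPow t) = expKernel t := by
  funext s
  have hs := one_add_ne_zero_of_re_pos s.2
  have h := zeroExt_apply (singularPow t) ⟨_, cayley_mem_openDisc s.2⟩
  dsimp only at h
  rw [halfPlaneTransform, h, singularPow, expKernel]
  congr 2
  dsimp only
  have : ((1 - (s : ℂ)) / (1 + s) + 1) = 2 / (1 + s) := by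
    field_simp
    ring
  rw [this]
  field_simp
  ring

theorem memHardyHalfPlane_expKernel {t : ℝ} (ht : 0 ≤ t) : MemHardyHalfPlane (expKernel t) := by
  rw [← halfPlaneTransform_singularPow]
  exact (memHardyDisc_singularPow ht).halfPlaneTransform

/-! ### Growth of functions in the Hardy space of the half-plane -/

theorem IsHolo.measurable_zeroExt {U : Set ℂ} (hU : MeasurableSet U) {f : U → ℂ}
    (hf : IsHolo f) : Measurable (zeroExt f) := by
  have hc : Continuous f := by
    have h := continuousOn_iff_continuous_domRestrict.1 (DifferentiableOn.continuousOn hf)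
    exact h.congr fun z => zeroExt_apply f z
  exact (MeasurableEmbedding.subtype_coe hU).measurable_extend hc.measurable measurable_zero

theorem measurableSet_rightHalfPlane : MeasurableSet rightHalfPlane :=
  measurableSet_lt measurable_const Complex.measurable_re

/-- Fubini: each vertical line of the translated strip lies in the half-plane, because `u > -x ≥ -Re
s`, and contributes at most the supremum. -/
theorem lintegral_strip_le (f : rightHalfPlane → ℂ) (hf : IsHolo f) {s : ℂ} {x : ℝ}
    (hs : x ≤ s.re) :
    ∫⁻ w in {w : ℂ | w.re ∈ Set.Ioo (-x) x}, ‖zeroExt f (s + w)‖ₑ ^ 2 ≤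
      halfPlaneNormSq f * ENNReal.ofReal (2 * x) := by
  have hm : Measurable fun w : ℂ => ‖zeroExt f (s + w)‖ₑ ^ 2 :=
    (((hf.measurable_zeroExt measurableSet_rightHalfPlane).comp
      (measurable_const_add s)).enorm).pow_const 2
  have hS : MeasurableSet {w : ℂ | w.re ∈ Set.Ioo (-x) x} :=
    Complex.measurable_re measurableSet_Ioo
  have hmp : Measurable fun p : ℝ × ℝ => {w : ℂ | w.re ∈ Set.Ioo (-x) x}.indicator
      (fun w : ℂ => ‖zeroExt f (s + w)‖ₑ ^ 2) (Complex.measurableEquivRealProd.symm p) :=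
    (hm.indicator hS).comp Complex.measurableEquivRealProd.symm.measurable
  rw [← lintegral_indicator hS, ← (Complex.volume_preserving_equiv_real_prod.symm).lintegral_comp_emb
    Complex.measurableEquivRealProd.symm.measurableEmbedding, Measure.volume_eq_prod,
    lintegral_prod _ hmp.aemeasurable]
  have hle : ∀ u : ℝ, ∫⁻ v : ℝ, {w : ℂ | w.re ∈ Set.Ioo (-x) x}.indicator
      (fun w : ℂ => ‖zeroExt f (s + w)‖ₑ ^ 2) (Complex.measurableEquivRealProd.symm (u, v)) ≤
      (Set.Ioo (-x) x).indicator (fun _ => halfPlaneNormSq f) u := by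
    intro u
    by_cases hu : u ∈ Set.Ioo (-x) x
    · rw [Set.indicator_of_mem hu]
      have hpos : 0 < s.re + u := by linarith [hu.1]
      refine le_trans (le_of_eq ?_) (le_iSup (fun x : {x : ℝ // 0 < x} => ∫⁻ y : ℝ,
        ‖zeroExt f (((x : ℝ) : ℂ) + (y : ℂ) * Complex.I)‖ₑ ^ 2) ⟨s.re + u, hpos⟩)
      refine (lintegral_congr fun v => ?_).trans (lintegral_add_left_eq_self _ s.im)
      rw [Set.indicator_of_mem (by simpa using hu)]
      congr 3
      apply Complex.ext <;> simp
    · rw [Set.indicator_of_notMem hu]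
      refine le_of_eq ((lintegral_congr fun v => ?_).trans lintegral_zero)
      exact Set.indicator_of_notMem (by simpa using hu) _
  refine (lintegral_mono hle).trans ?_
  rw [lintegral_indicator measurableSet_Ioo, setLIntegral_const, Real.volume_Ioo]
  refine le_of_eq ?_
  congr 2
  ring

/-- After rescaling to the unit disc, this compares the quadratic means at radii `0` and `ρ / x`. -/
theorem enorm_sq_mul_le_lintegral_ball {F : ℂ → ℂ} {s : ℂ} {x : ℝ} (hx : 0 < x)
    (hF : DifferentiableOn ℂ F (Metric.ball s x)) {ρ : ℝ} (h0 : 0 < ρ) (h1 : ρ < x) :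
    ENNReal.ofReal (2 * Real.pi) * ‖F s‖ₑ ^ 2 ≤
      ∫⁻ θ in Set.Ioo (-Real.pi) Real.pi, ‖F (s + circleMap 0 ρ θ)‖ₑ ^ 2 := by
  have hd : DifferentiableOn ℂ (fun ζ : ℂ => F (s + x * ζ)) (Metric.ball 0 1) := by
    refine DifferentiableOn.comp hF (by fun_prop) fun ζ hζ => ?_
    rw [mem_ball_zero_iff] at hζ
    rw [Metric.mem_ball, dist_eq_norm, add_sub_cancel_left, norm_mul, Complex.norm_real,
      Real.norm_of_nonneg hx.le]
    exact mul_lt_of_lt_one_right hx hζ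
  have h := lintegral_circleMap_sq_mono (hasSum_iteratedDeriv_div hd) le_rfl
    (div_pos h0 hx).le ((div_lt_one hx).2 h1)
  have e1 : ∀ θ, (x : ℂ) * circleMap 0 (ρ / x) θ = circleMap 0 ρ θ := by
    intro θ
    have : (x : ℂ) ≠ 0 := by exact_mod_cast hx.ne'
    simp only [circleMap_zero]
    push_cast
    field_simp
  simp only [e1] at h
  refine le_trans (le_of_eq ?_) h
  simp only [circleMap_zero_radius, Function.const_apply, mul_zero, add_zero]
  rw [setLIntegral_const, Real.volume_Ioo, mul_comm]
  congr 2
  ring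

/-- A local `L²` bound for holomorphic functions. -/
theorem enorm_sq_le_lintegral_ball {F : ℂ → ℂ} (hm : Measurable F) {s : ℂ} {x : ℝ} (hx : 0 < x)
    (hF : DifferentiableOn ℂ F (Metric.ball s x)) :
    ENNReal.ofReal (x / 2) * (ENNReal.ofReal (x / 2) * (ENNReal.ofReal (2 * Real.pi) *
      ‖F s‖ₑ ^ 2)) ≤ ∫⁻ w in Metric.ball (0 : ℂ) x, ‖F (s + w)‖ₑ ^ 2 := by
  have hm' : Measurable ((Metric.ball (0 : ℂ) x).indicator fun w => ‖F (s + w)‖ₑ ^ 2) :=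
    (((hm.comp (measurable_const_add s)).enorm).pow_const 2).indicator measurableSet_ball
  -- Only the annulus `x / 2 < ρ < x` is kept: its width gives one factor `x / 2`, and the polar
  -- weight `ρ > x / 2` the other.
  have hsub : Set.Ioo (x / 2) x ×ˢ Set.Ioo (-Real.pi) Real.pi ⊆ polarCoord.target := by
    rintro ⟨ρ, θ⟩ ⟨h1, h2⟩
    exact ⟨lt_trans (half_pos hx) h1.1, h2⟩
  have hmp : Measurable fun p : ℝ × ℝ => ENNReal.ofReal p.1 •
      (Metric.ball (0 : ℂ) x).indicator (fun w => ‖F (s + w)‖ₑ ^ 2)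
        (circleMap 0 p.1 p.2) := by
    have hc : Measurable fun p : ℝ × ℝ => circleMap 0 p.1 p.2 := by
      refine Continuous.measurable ?_
      unfold circleMap
      fun_prop
    exact (ENNReal.measurable_ofReal.comp measurable_fst).mul (hm'.comp hc)
  rw [← lintegral_indicator measurableSet_ball, ← Complex.lintegral_comp_polarCoord_symm]
  have e : ∀ p : ℝ × ℝ, Complex.polarCoord.symm p = circleMap 0 p.1 p.2 := by
    intro p
    rw [Complex.polarCoord_symm_apply, circleMap_zero, Complex.exp_mul_I]
    simp
  simp_rw [e]
  refine le_trans ?_ (lintegral_mono_set hsub)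
  rw [Measure.volume_eq_prod, ← Measure.prod_restrict, lintegral_prod _ hmp.aemeasurable]
  calc _ = ∫⁻ ρ in Set.Ioo (x / 2) x, ENNReal.ofReal (x / 2) *
        (ENNReal.ofReal (2 * Real.pi) * ‖F s‖ₑ ^ 2) := by
        rw [setLIntegral_const, Real.volume_Ioo, mul_comm]
        congr 2
        ring
    _ ≤ _ := by
        refine setLIntegral_mono' measurableSet_Ioo fun ρ hρ => ?_
        have h0 : 0 < ρ := lt_trans (half_pos hx) hρ.1
        simp only [smul_eq_mul]
        rw [lintegral_const_mul' _ _ ENNReal.ofReal_ne_top]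
        refine mul_le_mul' (ENNReal.ofReal_le_ofReal hρ.1.le) ?_
        refine (enorm_sq_mul_le_lintegral_ball hx hF h0 hρ.2).trans (le_of_eq ?_)
        refine lintegral_congr fun θ => ?_
        rw [Set.indicator_of_mem]
        simpa [abs_of_pos h0] using hρ.2

/-- Functions in the Hardy space of the half-plane are bounded on smaller half-planes. -/
theorem MemHardyHalfPlane.exists_norm_le {f : rightHalfPlane → ℂ} (hf : MemHardyHalfPlane f)
    {x : ℝ} (hx : 0 < x) : ∃ K : ℝ, ∀ s : ℂ, x ≤ s.re → ‖zeroExt f s‖ ≤ K := by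
  set c := ENNReal.ofReal (x / 2) * (ENNReal.ofReal (x / 2) * ENNReal.ofReal (2 * Real.pi))
    with hc
  have hx2 : ENNReal.ofReal (x / 2) ≠ 0 := by simpa using hx
  have hpi : ENNReal.ofReal (2 * Real.pi) ≠ 0 := by simpa using Real.pi_pos
  have hc0 : c ≠ 0 := mul_ne_zero hx2 (mul_ne_zero hx2 hpi)
  have hcT : c ≠ ∞ := by
    refine ENNReal.mul_ne_top ENNReal.ofReal_ne_top
      (ENNReal.mul_ne_top ENNReal.ofReal_ne_top ENNReal.ofReal_ne_top)
  set B := halfPlaneNormSq f * ENNReal.ofReal (2 * x) / c with hB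
  have hBT : B ≠ ∞ := ENNReal.div_ne_top
    (ENNReal.mul_ne_top hf.2.ne ENNReal.ofReal_ne_top) hc0
  refine ⟨Real.sqrt B.toReal, fun s hs => ?_⟩
  have hball : Metric.ball s x ⊆ rightHalfPlane := by
    intro w hw
    have h1 := (Complex.abs_re_le_norm (w - s)).trans_lt (mem_ball_iff_norm.1 hw)
    have h2 := (abs_lt.1 h1).1
    rw [Complex.sub_re] at h2
    show 0 < w.re
    linarith
  have h1 := enorm_sq_le_lintegral_ball
    (hf.1.measurable_zeroExt measurableSet_rightHalfPlane) hx (DifferentiableOn.mono hf.1 hball)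
  have hsub : Metric.ball (0 : ℂ) x ⊆ {w : ℂ | w.re ∈ Set.Ioo (-x) x} := by
    intro w hw
    exact abs_lt.1 ((Complex.abs_re_le_norm w).trans_lt (mem_ball_zero_iff.1 hw))
  have h2 := (h1.trans (lintegral_mono_set hsub)).trans (lintegral_strip_le f hf.1 hs)
  have h3 : ‖zeroExt f s‖ₑ ^ 2 ≤ B := by
    rw [hB, ENNReal.le_div_iff_mul_le (Or.inl hc0) (Or.inl hcT), hc]
    refine le_trans (le_of_eq ?_) h2
    ring
  refine Real.le_sqrt_of_sq_le ?_
  have h4 := ENNReal.toReal_mono hBT h3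
  rwa [ENNReal.toReal_pow, toReal_enorm] at h4

/-! ### Surjectivity of the transform -/

/-- The inverse transform `f ↦ 2 f((1 - z) / (1 + z)) / (1 + z)`. -/
def discTransform (f : rightHalfPlane → ℂ) (z : openDisc) : ℂ :=
  2 * zeroExt f ((1 - z) / (1 + z)) / (1 + z)

theorem one_add_ne_zero_of_mem_openDisc {z : ℂ} (hz : z ∈ openDisc) : 1 + z ≠ 0 := by
  rw [add_comm]
  exact add_one_ne_zero_of_mem_openDisc hz

theorem half_le_re_inv_one_add {ζ : ℂ} (hζ : ζ ∈ openDisc) : 1 / 2 ≤ ((1 + ζ)⁻¹).re := by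
  have hne := one_add_ne_zero_of_mem_openDisc hζ
  have hz : ‖ζ‖ < 1 := mem_ball_zero_iff.1 hζ
  have h2 : Complex.normSq ζ < 1 := by
    rw [Complex.normSq_eq_norm_sq]
    nlinarith [norm_nonneg ζ]
  rw [Complex.inv_re, le_div_iff₀ (Complex.normSq_pos.2 hne), Complex.normSq_apply]
  rw [Complex.normSq_apply] at h2
  simp
  nlinarith

theorem cayley_eq {z : ℂ} (hz : 1 + z ≠ 0) : (1 - z) / (1 + z) = 2 * (1 + z)⁻¹ - 1 := by
  field_simp
  ring

theorem cayley_mem_rightHalfPlane {z : ℂ} (hz : z ∈ openDisc) :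
    (1 - z) / (1 + z) ∈ rightHalfPlane := by
  have hne := one_add_ne_zero_of_mem_openDisc hz
  have hre : z.re < 1 := (Complex.re_le_norm z).trans_lt (mem_ball_zero_iff.1 hz)
  have h2 : Complex.normSq z < 1 := by
    rw [Complex.normSq_eq_norm_sq]
    nlinarith [norm_nonneg z, mem_ball_zero_iff.1 hz]
  show 0 < ((1 - z) / (1 + z)).re
  rw [Complex.div_re, ← add_div]
  refine div_pos ?_ (Complex.normSq_pos.2 hne)
  rw [Complex.normSq_apply] at h2
  simp
  nlinarith

theorem IsHolo.discTransform {f : rightHalfPlane → ℂ} (hf : IsHolo f) :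
    IsHolo (discTransform f) := by
  refine isHolo_of_differentiableOn (g := fun z => 2 * zeroExt f ((1 - z) / (1 + z)) / (1 + z)) ?_
  have hd : DifferentiableOn ℂ (fun s : ℂ => (1 - s) / (1 + s)) openDisc :=
    DifferentiableOn.div (by fun_prop) (by fun_prop) fun s hs => one_add_ne_zero_of_mem_openDisc hs
  exact ((DifferentiableOn.comp hf hd fun s hs => cayley_mem_rightHalfPlane hs).const_mul 2).div
    (by fun_prop) fun s hs => one_add_ne_zero_of_mem_openDisc hs

theorem halfPlaneTransform_discTransform (f : rightHalfPlane → ℂ) :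
    halfPlaneTransform (discTransform f) = f := by
  funext s
  have hs := one_add_ne_zero_of_re_pos s.2
  have h := zeroExt_apply (discTransform f) ⟨_, cayley_mem_openDisc s.2⟩
  dsimp only at h
  have h1 : 1 + (1 - (s : ℂ)) / (1 + s) = 2 / (1 + s) := by
    field_simp
    ring
  have h2 : (1 - (1 - (s : ℂ)) / (1 + s)) / (1 + (1 - (s : ℂ)) / (1 + s)) = s := by
    rw [h1]
    field_simp
    ring
  rw [halfPlaneTransform, h, discTransform]
  dsimp only
  rw [h2, h1, zeroExt_apply]
  field_simp

/-- The line integral of `f` is `(1 + x)⁻¹ / 2` times this circle integral, and that factor is at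
least `1 / 4` when `x ≤ 1`. -/
theorem lintegral_tangent_circle_discTransform_le (f : rightHalfPlane → ℂ) {x : ℝ} (hx : 0 < x)
    (hx1 : x ≤ 1) :
    ∫⁻ θ in Set.Ioo (-Real.pi) Real.pi, ‖zeroExt (discTransform f)
      (((1 + x)⁻¹ : ℝ) - 1 + ((1 + x)⁻¹ : ℝ) * circleMap 0 1 θ)‖ₑ ^ 2 ≤
      4 * halfPlaneNormSq f := by
  have h := lintegral_line_cayley hx (zeroExt (discTransform f))
  have e : ∀ y : ℝ, zeroExt (discTransform f)
      ((1 - (x + y * Complex.I)) / (1 + (x + y * Complex.I))) / (1 + (x + y * Complex.I)) =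
      zeroExt f (x + y * Complex.I) := by
    intro y
    have hm : (x + y * Complex.I : ℂ) ∈ rightHalfPlane := by simpa using hx
    have h1 := congrFun (halfPlaneTransform_discTransform f) ⟨_, hm⟩
    have h2 := zeroExt_apply f ⟨_, hm⟩
    exact h1.trans h2.symm
  simp_rw [e] at h
  have hM := le_iSup (fun x : {x : ℝ // 0 < x} => ∫⁻ y : ℝ,
    ‖zeroExt f (((x : ℝ) : ℂ) + (y : ℂ) * Complex.I)‖ₑ ^ 2) ⟨x, hx⟩
  dsimp only at hM
  rw [h] at hM
  have h4 : (1 : ℝ≥0∞) ≤ 4 * ENNReal.ofReal ((1 + x)⁻¹ / 2) := by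
    rw [show (4 : ℝ≥0∞) = ENNReal.ofReal 4 by norm_num, ← ENNReal.ofReal_mul (by norm_num),
      ENNReal.one_le_ofReal]
    have : (1 + x) ≤ 2 := by linarith
    have h2 : 2⁻¹ ≤ (1 + x)⁻¹ := inv_anti₀ (by linarith) this
    linarith
  refine (le_mul_of_one_le_left' h4).trans ?_
  rw [mul_assoc]
  exact mul_le_mul_right hM 4

theorem affine_mem_openDisc {r : ℝ} (h0 : 0 < r) (h1 : r < 1) {ζ : ℂ} (hζ : ζ ∈ openDisc) :
    (r - 1 + r * ζ : ℂ) ∈ openDisc := by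
  rw [mem_ball_zero_iff] at hζ ⊢
  refine (norm_add_le _ _).trans_lt ?_
  rw [← Complex.ofReal_one, ← Complex.ofReal_sub, norm_mul, Complex.norm_real, Complex.norm_real,
    Real.norm_of_nonneg h0.le, Real.norm_of_nonpos (by linarith)]
  nlinarith

/-- Since `Re (1 + ζ) ≥ 0`, adding `ε` moves the point away from `0`. The first bound controls the
denominator of the regularizing factor, the second its modulus. -/
theorem le_norm_one_add_add {ζ : ℂ} (hζ : ‖ζ‖ ≤ 1) {ε : ℝ} (hε : 0 < ε) :
    ε ≤ ‖1 + ε + ζ‖ ∧ ‖1 + ζ‖ ≤ ‖1 + ε + ζ‖ := by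
  have hre : 0 ≤ 1 + ζ.re := by linarith [neg_le_of_abs_le ((Complex.abs_re_le_norm ζ).trans hζ)]
  constructor
  · refine le_trans ?_ (Complex.re_le_norm _)
    simp
    linarith
  · refine (pow_le_pow_iff_left₀ (norm_nonneg _) (norm_nonneg _) two_ne_zero).1 ?_
    rw [← Complex.normSq_eq_norm_sq, ← Complex.normSq_eq_norm_sq, Complex.normSq_apply,
      Complex.normSq_apply]
    simp
    nlinarith

/-- The means of a regularization of the inverse transform, moved into the disc. -/
theorem lintegral_circleMap_regularized_le {f : rightHalfPlane → ℂ} (hf : MemHardyHalfPlane f)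
    {x : ℝ} (hx : 0 < x) (hx1 : x ≤ 1) {ρ : ℝ} (h0 : 0 ≤ ρ) (h1 : ρ < 1) :
    ∫⁻ θ in Set.Ioo (-Real.pi) Real.pi, ‖zeroExt (discTransform f)
      (((1 + x)⁻¹ : ℝ) - 1 + ((1 + x)⁻¹ : ℝ) * circleMap 0 ρ θ) *
        ((1 + circleMap 0 ρ θ) / (1 + x + circleMap 0 ρ θ))‖ₑ ^ 2 ≤ 4 * halfPlaneNormSq f := by
  have hA : 0 < 1 + x := by linarith
  obtain ⟨K, hK⟩ := hf.exists_norm_le hx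
  set r : ℝ := (1 + x)⁻¹ with hr
  have hr0 : 0 < r := inv_pos.2 hA
  have hr1 : r < 1 := inv_lt_one_of_one_lt₀ (by linarith)
  have hrx : r⁻¹ = 1 + x := inv_inv _
  have hrc : (r : ℂ) ≠ 0 := by exact_mod_cast hr0.ne'
  set G : ℂ → ℂ := fun ζ => zeroExt (discTransform f) (r - 1 + r * ζ) *
    ((1 + ζ) / (1 + x + ζ)) with hG
  have hgd : DifferentiableOn ℂ (zeroExt (discTransform f)) openDisc := hf.1.discTransform
  have hden : ∀ ζ : ℂ, ‖ζ‖ ≤ 1 → 1 + x + ζ ≠ 0 := fun ζ hζ =>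
    norm_pos_iff.1 (hx.trans_le (le_norm_one_add_add hζ hx).1)
  have hd : DifferentiableOn ℂ G openDisc := by
    refine (DifferentiableOn.comp hgd (by fun_prop) fun ζ hζ =>
      affine_mem_openDisc hr0 hr1 hζ).mul ?_
    exact DifferentiableOn.div (by fun_prop) (by fun_prop) fun ζ hζ =>
      hden ζ (mem_ball_zero_iff.1 hζ).le
  have hb : ∀ ζ ∈ Metric.ball (0 : ℂ) 1, ‖G ζ‖ ≤ 2 * K * (1 + x) / x := by
    intro ζ hζ
    have hm := affine_mem_openDisc hr0 hr1 hζ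
    have hne := one_add_ne_zero_of_mem_openDisc hζ
    have hne2 := hden ζ (mem_ball_zero_iff.1 hζ).le
    have h2 := zeroExt_apply (discTransform f) ⟨_, hm⟩
    dsimp only at h2
    have e : (1 + (r - 1 + r * ζ) : ℂ) = r * (1 + ζ) := by ring
    -- The point is `2 (1 + x) / (1 + ζ) - 1`, and `Re (1 / (1 + ζ)) ≥ 1 / 2`, so the tangent disc
    -- lands in the half-plane where `f` is bounded by `K`.
    have hs : x ≤ ((1 - (r - 1 + r * ζ)) / (1 + (r - 1 + r * ζ)) : ℂ).re := by
      rw [cayley_eq (one_add_ne_zero_of_mem_openDisc hm), e, mul_inv, ← Complex.ofReal_inv, hrx]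
      have h3 := half_le_re_inv_one_add hζ
      have h4 : (2 * (((1 + x : ℝ) : ℂ) * (1 + ζ)⁻¹) - 1).re =
          2 * ((1 + x) * ((1 + ζ)⁻¹).re) - 1 := by
        rw [Complex.sub_re, Complex.one_re, ← Complex.ofReal_ofNat, Complex.re_ofReal_mul,
          Complex.re_ofReal_mul]
      rw [h4]
      nlinarith
    have hKs := hK _ hs
    have hK0 : 0 ≤ K := (norm_nonneg _).trans hKs
    -- The numerator `1 + ζ` cancels the pole of the inverse transform at `ζ = -1`.
    have e2 : G ζ = 2 * zeroExt f ((1 - (r - 1 + r * ζ)) / (1 + (r - 1 + r * ζ))) *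
        (((1 + x : ℝ) : ℂ) / (1 + x + ζ)) := by
      simp only [hG]
      rw [h2, discTransform]
      dsimp only
      generalize zeroExt f _ = q
      have hrA : (r : ℂ) * ((1 + x : ℝ) : ℂ) = 1 := by
        rw [← Complex.ofReal_mul, hr, inv_mul_cancel₀ hA.ne', Complex.ofReal_one]
      rw [e]
      field_simp
      linear_combination -q * hrA
    rw [e2, norm_mul, norm_mul, norm_div, Complex.norm_ofNat, Complex.norm_real,
      Real.norm_of_nonneg hA.le, ← mul_div_assoc]
    exact div_le_div₀ (by positivity) (by gcongr) hx
      (le_norm_one_add_add (mem_ball_zero_iff.1 hζ).le hx).1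
  have hcirc : ∀ θ, ‖circleMap 0 1 θ‖ ≤ 1 := fun θ => by simp
  have hcont : ∀ θ ∈ Set.Ioo (-Real.pi) Real.pi, ContinuousAt G (circleMap 0 1 θ) := by
    intro θ hθ
    have h3 : ContinuousAt (zeroExt (discTransform f)) (r - 1 + r * circleMap 0 1 θ) :=
      hgd.continuousOn.continuousAt
        (Metric.isOpen_ball.mem_nhds (affine_circleMap_mem_openDisc hr0 hr1 hθ))
    refine ContinuousAt.mul (ContinuousAt.comp (f := fun ζ : ℂ => (r - 1 + r * ζ : ℂ)) h3
      (by fun_prop)) ?_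
    exact ContinuousAt.div (by fun_prop) (by fun_prop) (hden _ (hcirc θ))
  refine (lintegral_circleMap_sq_le_of_bounded (hasSum_iteratedDeriv_div hd) hd.continuousOn hb
    hcont h0 h1).trans ?_
  refine le_trans (lintegral_mono fun θ => ?_)
    (lintegral_tangent_circle_discTransform_le f hx hx1)
  dsimp only [hG]
  gcongr
  rw [enorm_mul]
  refine mul_le_of_le_one_right' ?_
  rw [← ofReal_norm, ENNReal.ofReal_le_one, norm_div]
  exact div_le_one_of_le₀ (le_norm_one_add_add (hcirc θ) hx).2 (norm_nonneg _)

-- On a fixed circle of radius `ρ < 1` the regularized functions converge pointwise to the inverse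
-- transform as `x → 0`, with square integrals bounded independently of `x` and `ρ`; Fatou's lemma
-- applies.
open Filter Topology in
theorem MemHardyHalfPlane.discTransform {f : rightHalfPlane → ℂ} (hf : MemHardyHalfPlane f) :
    MemHardyDisc (discTransform f) := by
  have hM : 4 * halfPlaneNormSq f ≠ ∞ := ENNReal.mul_ne_top (by norm_num) hf.2.ne
  have hgd : DifferentiableOn ℂ (zeroExt (_root_.discTransform f)) openDisc := hf.1.discTransform
  refine (memHardyDisc_of_lintegral_le hf.1.discTransform
    (C := (4 * halfPlaneNormSq f).toReal / (2 * Real.pi)) (by positivity) fun ρ h0 h1 => ?_).1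
  rw [mul_div_cancel₀ _ (by positivity), ENNReal.ofReal_toReal hM]
  set x : ℕ → ℝ := fun n => 1 / ((n : ℝ) + 1) with hx
  have hx0 : ∀ n, 0 < x n := fun n => by simp only [hx]; positivity
  have hx1 : ∀ n, x n ≤ 1 := fun n => by
    simp only [hx]
    rw [div_le_one (by positivity)]
    linarith [n.cast_nonneg (α := ℝ)]
  have hlim : Tendsto x atTop (𝓝 0) := tendsto_one_div_add_atTop_nhds_zero_nat
  have hlimr : Tendsto (fun n => (((1 + x n)⁻¹ : ℝ) : ℂ)) atTop (𝓝 1) := by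
    have := (hlim.const_add 1).inv₀ (by norm_num)
    rw [add_zero, inv_one] at this
    exact (Complex.continuous_ofReal.tendsto 1).comp this
  have hmem : ∀ θ, circleMap 0 ρ θ ∈ openDisc := fun θ => by simpa [abs_of_pos h0] using h1
  have hmg := hf.1.discTransform.measurable_zeroExt measurableSet_ball
  refine lintegral_le_of_tendsto_of_le (fun n => ?_) (Eventually.of_forall fun θ => ?_)
    fun n => lintegral_circleMap_regularized_le hf (hx0 n) (hx1 n) h0.le h1
  · have hc : Measurable (circleMap 0 ρ) := (continuous_circleMap 0 ρ).measurable
    exact (((hmg.comp ((hc.const_mul _).const_add _)).mul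
      ((hc.const_add _).div (hc.const_add _))).enorm).pow_const 2
  · refine ((ENNReal.continuous_pow 2).tendsto _).comp ((continuous_enorm.tendsto _).comp ?_)
    have hca : ContinuousAt (zeroExt (_root_.discTransform f)) (circleMap 0 ρ θ) :=
      hgd.continuousOn.continuousAt (Metric.isOpen_ball.mem_nhds (hmem θ))
    have ha : Tendsto (fun n => (((1 + x n)⁻¹ : ℝ) : ℂ) - 1 +
        (((1 + x n)⁻¹ : ℝ) : ℂ) * circleMap 0 ρ θ) atTop (𝓝 (circleMap 0 ρ θ)) := by
      have := (hlimr.sub_const 1).add (hlimr.mul_const (circleMap 0 ρ θ))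
      simpa using this
    have hq : Tendsto (fun n => (1 + circleMap 0 ρ θ) / (1 + (x n : ℂ) + circleMap 0 ρ θ)) atTop
        (𝓝 1) := by
      have hne := one_add_ne_zero_of_mem_openDisc (hmem θ)
      have hxc : Tendsto (fun n => (x n : ℂ)) atTop (𝓝 0) := by
        have := (Complex.continuous_ofReal.tendsto 0).comp hlim
        simpa [Function.comp_def] using this
      have := (tendsto_const_nhds (x := 1 + circleMap 0 ρ θ)).div
        ((hxc.const_add 1).add_const (circleMap 0 ρ θ)) (by simpa using hne)
      rwa [add_zero, div_self hne] at this
    have := (hca.tendsto.comp ha).mul hq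
    rwa [mul_one] at this

theorem hardyTransform_surjective : Function.Surjective hardyTransform := by
  intro f
  refine ⟨(⟨discTransform f.toFun, f.mem.discTransform⟩ : hardyDiscSubmodule), ?_⟩
  exact HardyHalfPlane.toFun_injective (halfPlaneTransform_discTransform f.toFun)

theorem topologicalClosure_span_expKernel :
    (Submodule.span ℂ
      {f : HardyHalfPlane | ∃ t : ℝ, 0 ≤ t ∧ f.toFun = expKernel t}).topologicalClosure = ⊤ := by
  rw [← Submodule.dense_iff_topologicalClosure_eq_top]
  have hd := Submodule.dense_iff_topologicalClosure_eq_top.2 topologicalClosure_span_singularPow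
  -- The image of the dense span on the disc is dense, and it lies in the span of the transformed
  -- generators.
  refine (hardyTransform_surjective.denseRange.dense_image hardyTransform.continuous hd).mono ?_
  refine (Submodule.map_span_le hardyTransform.toLinearMap _ _).2 ?_
  rintro f ⟨t, ht, hf⟩
  refine Submodule.subset_span ⟨t, ht, ?_⟩
  rw [← halfPlaneTransform_singularPow, ← hf]
  rfl

end

theorem mainTheorem9 :
    ((∀ t : ℝ, 0 ≤ t → MemHardyDisc (singularPow t)) ∧
      (Submodule.span ℂ
        {f : HardyDisc | ∃ t : ℝ, 0 ≤ t ∧ f.toFun = singularPow t}).topologicalClosure = ⊤) ∧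
    ((∀ t : ℝ, 0 ≤ t → MemHardyHalfPlane (expKernel t)) ∧
      (Submodule.span ℂ
        {f : HardyHalfPlane | ∃ t : ℝ, 0 ≤ t ∧ f.toFun = expKernel t}).topologicalClosure = ⊤) :=
  ⟨⟨fun _ ht => memHardyDisc_singularPow ht, topologicalClosure_span_singularPow⟩,
    fun _ ht => memHardyHalfPlane_expKernel ht, topologicalClosure_span_expKernel⟩
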